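/- Let $c$ be a positive integer, let $\hbar,\mu,\nu$ be real numbers, let $\mathbf T=\mathbf R/\mathbf Z$, and let $H=L^2(\mathbf R\times\mathbf T\times\mathbf Z)$ with respect to Haar measure. Let $S^c$ be the space of $C^\infty$ functions $\Phi$ on $\mathbf R\times\mathbf T\times\mathbf Z$ such that (a) $\Phi(x+k,y,p)=e^{ickpy}\,\Phi(x,y,p)$ for all $k\in2\pi\mathbf Z$; and (b) for every polynomial $P$ on $\mathbf Z$, all integers $m,n\ge 0$ and every compact $C\subset\mathbf R\times\mathbf T$, the function $P(p)\,\dfrac{\partial^{m+n}\Phi}{\partial x^m\partial y^n}(x,y,p)$ is bounded on $C\times\mathbf Z$. Every $\Phi\in S^c$ acts on $H$ as the bounded operator $$(\Phi\xi)(x,y,p)=\sum_{q\in\mathbf Z}\Phi\bigl(x-\hbar(q-2p)\mu,\;y-\hbar(q-2p)\nu,\;q\bigr)\,\xi(x,y,p-q),$$ so that $S^c\subset B(H)$. Let $N_\hbar$ be the closure of $S^c$ in $B(H)$ for the weak operator topology. Theorem. An operator $T\in B(H)$ belongs to $N_\hbar$ if and only if $T$ commutes with all of the operators $$(V_f\xi)(x,y,p)=f(x,y)\,\xi(x,y,p),\qquad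 f\in L^\infty(\mathbf R\times\mathbf T),$$ $$(W_k\xi)(x,y,p)=e^{-ick(p^2\hbar\nu+py)}\,\xi(x+k,y,p),\qquad k\in2\pi\mathbf Z,$$ $$(X_r\xi)(x,y,p)=\xi(x-2\hbar r\mu,\;y-2\hbar r\nu,\;p+r),\qquad r\in\mathbf Z.$$ -/

import Mathlib

open MeasureTheory Filter Topology
open scoped ENNReal

noncomputable section

namespace QuantumHeisenberg

/-- The group `ℝ × 𝕋 × ℤ`, with `𝕋 = ℝ / ℤ`. -/
abbrev G : Type := ℝ × UnitAddCircle × ℤ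

/-- Haar measure on `ℝ × 𝕋 × ℤ`: Lebesgue measure times Haar measure times counting measure. -/
def haar : Measure G :=
  (volume : Measure ℝ).prod ((volume : Measure UnitAddCircle).prod (Measure.count : Measure ℤ))

/-- Haar measure on `ℝ × 𝕋`. -/
def haarRT : Measure (ℝ × UnitAddCircle) :=
  (volume : Measure ℝ).prod (volume : Measure UnitAddCircle)

instance : SigmaFinite haar := by unfold haar; infer_instance

instance : haar.IsAddRightInvariant := by
  unfold haar
  have : MeasurableAdd (UnitAddCircle × ℤ) := inferInstance
  exact Measure.prod.instIsAddRightInvariant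

/-- The Hilbert space `L²(ℝ × 𝕋 × ℤ)`. -/
abbrev H : Type := Lp ℂ 2 haar

/-! ### Multiplication and translation operators -/

/-- Multiplication by an essentially bounded function. -/
def mulOp (g : G → ℂ) (hg : MemLp g ∞ haar) : H →L[ℂ] H :=
  (ContinuousLinearMap.mul ℂ ℂ).holderL haar ∞ 2 2 (hg.toLp g)

theorem mulOp_ae (g : G → ℂ) (hg : MemLp g ∞ haar) (ξ : H) :
    ∀ᵐ z ∂haar, mulOp g hg ξ z = g z * ξ z := by
  have h1 := (ContinuousLinearMap.mul ℂ ℂ).coeFn_holder (r := 2) (hg.toLp g) ξ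
  filter_upwards [h1, hg.coeFn_toLp] with z h1 h2
  simp only [mulOp, ContinuousLinearMap.holderL_apply_apply]
  rw [h1, h2]
  rfl

/-- Translation: `(τ_a ξ)(z) = ξ(z + a)`. -/
def transOp (a : G) : H →L[ℂ] H :=
  (Lp.compMeasurePreservingₗᵢ ℂ (fun z : G => z + a)
    (measurePreserving_add_right haar a)).toContinuousLinearMap

theorem transOp_ae (a : G) (ξ : H) : ∀ᵐ z ∂haar, transOp a ξ z = ξ (z + a) :=
  Lp.coeFn_compMeasurePreserving ξ (measurePreserving_add_right haar a)

theorem quasiMeasurePreserving_proj :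
    Measure.QuasiMeasurePreserving (fun z : G => (z.1, z.2.1)) haar haarRT := by
  have h : MeasurePreserving (MeasurableEquiv.prodAssoc.symm :
      G ≃ᵐ (ℝ × UnitAddCircle) × ℤ) haar (haarRT.prod Measure.count) :=
    (measurePreserving_prodAssoc volume volume Measure.count).symm
  exact Measure.quasiMeasurePreserving_fst.comp h.quasiMeasurePreserving

theorem memLp_proj (f : Lp ℂ ∞ haarRT) :
    MemLp (fun z : G => f (z.1, z.2.1)) ∞ haar := by
  have hm : AEStronglyMeasurable (fun z : G => f (z.1, z.2.1)) haar :=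
    (Lp.aestronglyMeasurable f).comp_quasiMeasurePreserving quasiMeasurePreserving_proj
  refine memLp_top_of_bound hm (eLpNormEssSup f haarRT).toReal ?_
  have hf : eLpNormEssSup f haarRT < ∞ := by
    rw [← eLpNorm_exponent_top]; exact (Lp.memLp f).2
  refine quasiMeasurePreserving_proj.ae (p := fun w => ‖f w‖ ≤ _) ?_
  filter_upwards [ae_le_eLpNormEssSup (f := f) (μ := haarRT)] with w hw
  rw [← toReal_enorm]
  exact ENNReal.toReal_mono hf.ne hw

/-- `(V_f ξ)(x, y, p) = f(x, y) ξ(x, y, p)` for `f ∈ L^∞(ℝ × 𝕋)`. -/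
def V (f : Lp ℂ ∞ haarRT) : H →L[ℂ] H :=
  mulOp (fun z => f (z.1, z.2.1)) (memLp_proj f)

/-- The function `e^{-ick(p²ħν + py)}` on `ℝ × 𝕋 × ℤ` for `k = 2πm`. It is well defined for
`y ∈ 𝕋 = ℝ / ℤ`, since the factor `e^{-ickpy} = e^{-2πi(cmp)y}` is the character
`fourier (-(c m p))` of `𝕋`. -/
def phase (c : ℕ) (ħ ν : ℝ) (m : ℤ) (z : G) : ℂ :=
  Complex.exp (-(Complex.I * c * (2 * Real.pi * m) * ((z.2.2 : ℂ) ^ 2 * ħ * ν))) *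
    fourier (-((c : ℤ) * m * z.2.2)) z.2.1

theorem phase_coe (c : ℕ) (ħ ν : ℝ) (m : ℤ) (x y : ℝ) (p : ℤ) :
    phase c ħ ν m (x, (y : UnitAddCircle), p) =
      Complex.exp (-(Complex.I * c * (2 * Real.pi * m) * ((p : ℂ) ^ 2 * ħ * ν + p * y))) := by
  simp only [phase, fourier_coe_apply]
  rw [← Complex.exp_add]
  congr 1
  push_cast
  ring

theorem norm_phase (c : ℕ) (ħ ν : ℝ) (m : ℤ) (z : G) : ‖phase c ħ ν m z‖ = 1 := by
  obtain ⟨x, y, p⟩ := z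
  induction y using QuotientAddGroup.induction_on with
  | H y =>
    have h := phase_coe c ħ ν m x y p
    rw [show phase c ħ ν m (x, (QuotientAddGroup.mk y : UnitAddCircle), p) = _ from h]
    rw [show -(Complex.I * c * (2 * Real.pi * m) * ((p : ℂ) ^ 2 * ħ * ν + p * y)) =
      ((-(c * (2 * Real.pi * m) * ((p : ℝ) ^ 2 * ħ * ν + p * y)) : ℝ) : ℂ) * Complex.I by
        push_cast; ring]
    exact Complex.norm_exp_ofReal_mul_I _

theorem continuous_G {F : G → ℂ}
    (h : ∀ p : ℤ, Continuous fun w : ℝ × UnitAddCircle => F (w.1, w.2, p)) : Continuous F := by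
  have h' : Continuous fun w : ℤ × (ℝ × UnitAddCircle) => F (w.2.1, w.2.2, w.1) :=
    continuous_prod_of_discrete_left.mpr h
  exact h'.comp (g := fun w : ℤ × (ℝ × UnitAddCircle) => F (w.2.1, w.2.2, w.1))
    (f := fun z : G => (z.2.2, (z.1, z.2.1))) (by fun_prop)

theorem memLp_phase (c : ℕ) (ħ ν : ℝ) (m : ℤ) : MemLp (phase c ħ ν m) ∞ haar := by
  refine memLp_top_of_bound (Continuous.aestronglyMeasurable (continuous_G fun p => ?_)) 1
    (.of_forall fun z => (norm_phase c ħ ν m z).le)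
  simp only [phase]
  fun_prop

/-- `(W_k ξ)(x, y, p) = e^{-ick(p²ħν + py)} ξ(x + k, y, p)` for `k = 2πm ∈ 2πℤ`. -/
def W (c : ℕ) (ħ ν : ℝ) (m : ℤ) : H →L[ℂ] H :=
  mulOp (phase c ħ ν m) (memLp_phase c ħ ν m) ∘L transOp (2 * Real.pi * m, 0, 0)

/-- `(X_r ξ)(x, y, p) = ξ(x - 2ħrμ, y - 2ħrν, p + r)` for `r ∈ ℤ`. -/
def X (ħ μ ν : ℝ) (r : ℤ) : H →L[ℂ] H :=
  transOp (-(2 * ħ * r * μ), ((-(2 * ħ * r * ν) : ℝ) : UnitAddCircle), r)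

theorem V_ae (f : Lp ℂ ∞ haarRT) (ξ : H) :
    ∀ᵐ z ∂haar, V f ξ z = f (z.1, z.2.1) * ξ z :=
  mulOp_ae _ _ ξ

theorem W_ae (c : ℕ) (ħ ν : ℝ) (m : ℤ) (ξ : H) :
    ∀ᵐ z ∂haar, W c ħ ν m ξ z = phase c ħ ν m z * ξ (z.1 + 2 * Real.pi * m, z.2.1, z.2.2) := by
  filter_upwards [mulOp_ae _ (memLp_phase c ħ ν m) (transOp (2 * Real.pi * m, 0, 0) ξ),
    transOp_ae (2 * Real.pi * m, 0, 0) ξ] with z h1 h2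
  rw [W, ContinuousLinearMap.comp_apply, h1, h2]
  simp [Prod.add_def]

theorem X_ae (ħ μ ν : ℝ) (r : ℤ) (ξ : H) :
    ∀ᵐ z ∂haar, X ħ μ ν r ξ z =
      ξ (z.1 - 2 * ħ * r * μ, z.2.1 - ((2 * ħ * r * ν : ℝ) : UnitAddCircle), z.2.2 + r) := by
  filter_upwards [transOp_ae
    (-(2 * ħ * r * μ), ((-(2 * ħ * r * ν) : ℝ) : UnitAddCircle), r) ξ] with z h
  rw [X, h]
  simp [Prod.add_def, sub_eq_add_neg]

/-! ### The space `S^c` and its action -/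

/-- The partial derivative `∂^{m+n}Φ / ∂x^m ∂y^n` at `(x, y mod 1, p)`. -/
def partialDeriv (m n : ℕ) (Φ : G → ℂ) (x y : ℝ) (p : ℤ) : ℂ :=
  iteratedDeriv m (fun x' : ℝ =>
    iteratedDeriv n (fun y' : ℝ => Φ (x', (y' : UnitAddCircle), p)) y) x

/-- The space `S^c` of smooth functions on `ℝ × 𝕋 × ℤ`. A function on `ℝ × 𝕋` is smooth when its
lift to the universal cover `ℝ × ℝ` is smooth. -/
structure IsSc (c : ℕ) (Φ : G → ℂ) : Prop where
  smooth : ∀ p : ℤ, ContDiff ℝ (⊤ : ℕ∞) fun w : ℝ × ℝ => Φ (w.1, (w.2 : UnitAddCircle), p)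
  twisted : ∀ (m : ℤ) (x y : ℝ) (p : ℤ),
    Φ (x + 2 * Real.pi * m, (y : UnitAddCircle), p) =
      Complex.exp (Complex.I * c * (2 * Real.pi * m) * p * y) * Φ (x, (y : UnitAddCircle), p)
  bounded : ∀ (P : Polynomial ℂ) (m n : ℕ) (C : Set (ℝ × UnitAddCircle)), IsCompact C →
    ∃ B : ℝ, ∀ (x y : ℝ) (p : ℤ), (x, (y : UnitAddCircle)) ∈ C →
      ‖P.eval (p : ℂ) * partialDeriv m n Φ x y p‖ ≤ B

/-- The bounded operator `A` on `L²(ℝ × 𝕋 × ℤ)` is the action of `Φ`: for every `ξ`,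
`(Aξ)(x, y, p) = ∑_q Φ(x - ħ(q - 2p)μ, y - ħ(q - 2p)ν, q) ξ(x, y, p - q)` almost everywhere. -/
def ActsBy (ħ μ ν : ℝ) (Φ : G → ℂ) (A : H →L[ℂ] H) : Prop :=
  ∀ ξ : H, ∀ᵐ z ∂haar, HasSum
    (fun q : ℤ => Φ (z.1 - ħ * (q - 2 * z.2.2) * μ,
        z.2.1 - ((ħ * (q - 2 * z.2.2) * ν : ℝ) : UnitAddCircle), q) *
      ξ (z.1, z.2.1, z.2.2 - q))
    (A ξ z)

theorem IsSc.continuous {c : ℕ} {Φ : G → ℂ} (h : IsSc c Φ) : Continuous Φ := by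
  refine continuous_G fun p => ?_
  have hq : IsOpenQuotientMap (fun w : ℝ × ℝ => (w.1, (w.2 : UnitAddCircle))) :=
    IsOpenQuotientMap.id.prodMap QuotientAddGroup.isOpenQuotientMap_mk
  exact hq.isQuotientMap.continuous_iff.mpr (h.smooth p).continuous

/-- A function in `S^c` decays in `p`, uniformly on `ℝ × 𝕋`. -/
theorem IsSc.exists_bound {c : ℕ} {Φ : G → ℂ} (h : IsSc c Φ) :
    ∃ b : ℤ → ℝ, Summable b ∧ ∀ z : G, ‖Φ z‖ ≤ b z.2.2 := by
  obtain ⟨B, hB⟩ := h.bounded (1 + Polynomial.X ^ 2) 0 0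
    (Set.Icc 0 (2 * Real.pi) ×ˢ Set.univ) (isCompact_Icc.prod isCompact_univ)
  have hs : Summable fun p : ℤ => B * (1 / (1 + (p : ℝ) ^ 2)) := by
    refine Summable.mul_left B ?_
    have h2 : Summable fun p : ℤ => 1 / (p : ℝ) ^ 2 :=
      Real.summable_one_div_int_pow.mpr one_lt_two
    refine (h2.add (hasSum_ite_eq (0 : ℤ) (1 : ℝ)).summable).of_nonneg_of_le
      (fun p => by positivity) ?_
    · intro p
      by_cases hp : p = 0
      · simp [hp]
      · simp only [hp, if_false, add_zero]
        have : (0 : ℝ) < (p : ℝ) ^ 2 := by positivity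
        exact one_div_le_one_div_of_le this (by linarith)
  refine ⟨_, hs, ?_⟩
  rintro ⟨x, y, p⟩
  induction y using QuotientAddGroup.induction_on with
  | H y =>
    obtain ⟨m, hm, -⟩ := existsUnique_add_zsmul_mem_Ico Real.two_pi_pos x 0
    have hx : x + 2 * Real.pi * m ∈ Set.Icc 0 (2 * Real.pi) := by
      have h0 : x + m • (2 * Real.pi) = x + 2 * Real.pi * m := by simp [mul_comm]
      rw [h0] at hm
      exact ⟨hm.1, by linarith [hm.2]⟩
    have h1 := hB (x + 2 * Real.pi * m) y p ⟨hx, Set.mem_univ _⟩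
    simp only [partialDeriv, iteratedDeriv_zero] at h1
    rw [h.twisted, norm_mul, norm_mul, show Complex.I * c * (2 * Real.pi * m) * p * y =
      ((c * (2 * Real.pi * m) * p * y : ℝ) : ℂ) * Complex.I by push_cast; ring,
      Complex.norm_exp_ofReal_mul_I, one_mul] at h1
    have h2 : ‖Polynomial.eval (p : ℂ) (1 + Polynomial.X ^ 2)‖ = 1 + (p : ℝ) ^ 2 := by
      rw [show Polynomial.eval (p : ℂ) (1 + Polynomial.X ^ 2) = ((1 + (p : ℝ) ^ 2 : ℝ) : ℂ) by
        simp, Complex.norm_real, Real.norm_of_nonneg (by positivity)]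
    rw [h2] at h1
    change ‖Φ (x, (y : UnitAddCircle), p)‖ ≤ B * (1 / (1 + (p : ℝ) ^ 2))
    rw [mul_one_div, le_div_iff₀ (by positivity)]
    linarith

theorem ActsBy.unique {ħ μ ν : ℝ} {Φ : G → ℂ} {A B : H →L[ℂ] H}
    (hA : ActsBy ħ μ ν Φ A) (hB : ActsBy ħ μ ν Φ B) : A = B := by
  ext1 ξ
  refine Lp.ext ?_
  filter_upwards [hA ξ, hB ξ] with z h1 h2
  exact h1.unique h2

/-- Every `Φ ∈ S^c` acts by a bounded operator, so that `S^c ⊂ B(H)`. -/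
theorem IsSc.exists_actsBy {c : ℕ} (ħ μ ν : ℝ) {Φ : G → ℂ} (h : IsSc c Φ) :
    ∃ A : H →L[ℂ] H, ActsBy ħ μ ν Φ A := by
  obtain ⟨b, hb, hΦ⟩ := h.exists_bound
  have hb0 : ∀ q, 0 ≤ b q := fun q => (norm_nonneg _).trans (hΦ (0, 0, q))
  set g : ℤ → G → ℂ := fun q z => Φ (z.1 - ħ * (q - 2 * z.2.2) * μ,
    z.2.1 - ((ħ * (q - 2 * z.2.2) * ν : ℝ) : UnitAddCircle), q) with hg
  have hgb : ∀ q z, ‖g q z‖ ≤ b q := fun q z => hΦ _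
  have hgm : ∀ q, MemLp (g q) ∞ haar := fun q => by
    refine memLp_top_of_bound (Continuous.aestronglyMeasurable (continuous_G fun p => ?_)) (b q)
      (.of_forall (hgb q))
    exact h.continuous.comp (by fun_prop)
  set M : ℤ → H →L[ℂ] H := fun q => mulOp (g q) (hgm q) ∘L transOp (0, 0, -q) with hM
  have hMae : ∀ q ξ, ∀ᵐ z ∂haar, M q ξ z = g q z * ξ (z.1, z.2.1, z.2.2 - q) := fun q ξ => by
    filter_upwards [mulOp_ae _ (hgm q) (transOp (0, 0, -q) ξ),
      transOp_ae (0, 0, -q) ξ] with z h1 h2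
    rw [hM]
    simp only [ContinuousLinearMap.comp_apply]
    rw [h1, h2]
    simp [Prod.add_def, sub_eq_add_neg]
  have hMn : ∀ q, ‖M q‖ ≤ b q := fun q => by
    refine ContinuousLinearMap.opNorm_le_bound _ (hb0 q) fun ξ => ?_
    have hT : ‖transOp (0, 0, -q) ξ‖ = ‖ξ‖ := LinearIsometry.norm_map _ ξ
    rw [← hT]
    refine Lp.norm_le_mul_norm_of_ae_le_mul ?_
    filter_upwards [mulOp_ae _ (hgm q) (transOp (0, 0, -q) ξ)] with z h1
    simp only [hM, ContinuousLinearMap.comp_apply]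
    rw [h1, norm_mul]
    exact mul_le_mul_of_nonneg_right (hgb q z) (norm_nonneg _)
  have hMs : Summable M := .of_norm_bounded hb hMn
  refine ⟨∑' q, M q, fun ξ => ?_⟩
  have hsum : HasSum (fun q => M q ξ) ((∑' q, M q) ξ) :=
    hMs.hasSum.mapL (ContinuousLinearMap.apply ℂ H ξ)
  -- pointwise summability
  have hpt : ∀ᵐ z ∂haar, Summable fun q : ℤ => g q z * ξ (z.1, z.2.1, z.2.2 - q) := by
    have hI : ∫⁻ z, ‖ξ z‖ₑ ^ 2 ∂haar ≠ ∞ := by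
      have := (Lp.memLp ξ).2
      have h2 := eLpNorm_lt_top_iff_lintegral_rpow_enorm_lt_top (f := ξ) (μ := haar)
        (p := 2) two_ne_zero ENNReal.ofNat_ne_top
      have h3 := h2.mp this
      simpa using h3.ne
    have hmeas : Measurable fun z : G => ‖ξ z‖ₑ ^ 2 :=
      ((Lp.stronglyMeasurable ξ).measurable.enorm).pow_const 2
    have hmq : ∀ q : ℤ, Measurable fun z : G =>
        ENNReal.ofReal (b q) * ‖ξ (z + (0, 0, -q))‖ₑ ^ 2 := fun q =>
      Measurable.const_mul (hmeas.comp (measurable_add_const _)) _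
    have hJ : ∫⁻ z, ∑' q : ℤ, ENNReal.ofReal (b q) * ‖ξ (z + (0, 0, -q))‖ₑ ^ 2 ∂haar ≠ ∞ := by
      rw [lintegral_tsum fun q => (hmq q).aemeasurable]
      have : ∀ q : ℤ, ∫⁻ z, ENNReal.ofReal (b q) * ‖ξ (z + (0, 0, -q))‖ₑ ^ 2 ∂haar =
          ENNReal.ofReal (b q) * ∫⁻ z, ‖ξ z‖ₑ ^ 2 ∂haar := fun q => by
        rw [lintegral_const_mul' _ _ ENNReal.ofReal_ne_top,
          lintegral_add_right_eq_self (fun z => ‖ξ z‖ₑ ^ 2)]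
      simp_rw [this]
      rw [ENNReal.tsum_mul_right]
      exact ENNReal.mul_ne_top hb.tsum_ofReal_ne_top hI
    have hm2 : Measurable fun z : G =>
        ∑' q : ℤ, ENNReal.ofReal (b q) * ‖ξ (z + (0, 0, -q))‖ₑ ^ 2 :=
      .tsum hmq
    filter_upwards [ae_lt_top hm2 hJ] with z hz
    have hs : Summable fun q : ℤ => b q * ‖ξ (z + (0, 0, -q))‖ ^ 2 := by
      have := ENNReal.summable_toReal hz.ne
      refine this.congr fun q => ?_
      simp [ENNReal.toReal_ofReal (hb0 q)]
    refine .of_norm_bounded (hb.add hs) fun q => ?_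
    have he : z + (0, 0, -q) = (z.1, z.2.1, z.2.2 - q) := by
      simp [Prod.add_def, sub_eq_add_neg]
    rw [he, norm_mul]
    have h1 := hgb q z
    have h2 := norm_nonneg (ξ (z.1, z.2.1, z.2.2 - q))
    nlinarith [hb0 q, mul_le_mul_of_nonneg_right h1 h2,
      mul_nonneg (hb0 q) (sq_nonneg (‖ξ (z.1, z.2.1, z.2.2 - q)‖ - 1)),
      mul_nonneg (hb0 q) (sq_nonneg (‖ξ (z.1, z.2.1, z.2.2 - q)‖))]
  obtain ⟨s, hs⟩ := exists_seq_tendsto (atTop : Filter (Finset ℤ))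
  have hT : Tendsto (fun n => ∑ q ∈ s n, M q ξ) atTop (𝓝 ((∑' q, M q) ξ)) := hsum.comp hs
  obtain ⟨k, hk, hae⟩ := (tendstoInMeasure_of_tendsto_Lp hT).exists_seq_tendsto_ae
  have hfin : ∀ᵐ z ∂haar, ∀ n, (∑ q ∈ s n, M q ξ : H) z = ∑ q ∈ s n, M q ξ z :=
    ae_all_iff.mpr fun n => by
      have := Lp.coeFn_finsetSum (s n) (fun q => M q ξ)
      filter_upwards [this] with z hz
      simpa using hz
  filter_upwards [hpt, hae, hfin, ae_all_iff.mpr fun q => hMae q ξ] with z h1 h2 h3 h4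
  have h5 := h1.hasSum.comp (hs.comp hk.tendsto_atTop)
  have h6 := tendsto_nhds_unique h2 (h5.congr fun n => by
    simp only [Function.comp_apply]
    rw [h3]
    exact Finset.sum_congr rfl fun q _ => (h4 q).symm)
  rw [h6]
  exact h1.hasSum

/-- `N_ħ`: the closure of `S^c ⊂ B(H)` in the weak operator topology. -/
def N (c : ℕ) (ħ μ ν : ℝ) : Set (H →L[ℂ] H) :=
  {T | ContinuousLinearMapWOT.ofCLM T ∈
    closure (ContinuousLinearMapWOT.ofCLM '' {A : H →L[ℂ] H | ∃ Φ, IsSc c Φ ∧ ActsBy ħ μ ν Φ A})}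

end QuantumHeisenberg

end

open MeasureTheory Filter Topology
open scoped ENNReal

noncomputable section

namespace QuantumHeisenberg

/-! ### The weak operator topology -/

section WeakOperatorTopology

universe u

variable {E : Type u} [NormedAddCommGroup E] [InnerProductSpace ℂ E]

/-! One direction is a computation: the operators of `S^c` commute with `V`, `W` and `X`, and
commuting with a fixed operator is a weakly closed condition.

Conversely, let `T` commute with all three families. Weak operator neighbourhoods constrain finitely
many matrix coefficients, so by finite-dimensional duality it suffices that every functional `∑ ⟪η
i, · (ξ i)⟫` vanishing on `S^c` vanishes at `T`. Commuting with `V` makes `T` a ℤ × ℤ matrix of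
functions on ℝ × 𝕋 (`apply_levelProj_ae`). Conjugation by the gauge unitaries gives a continuous
function of θ ∈ 𝕋 whose value at 0 is the functional at `T` and whose Fourier coefficients are its
values on the diagonals of that matrix. Uniqueness of Fourier coefficients reduces the claim to
single diagonals, with no convergence of the sum of the diagonals to discuss.

On one diagonal the functional is integration of the kernel against an integrable density.
Commutation with `X` and `W` determines the kernel by its restriction φ to one level over (0, 2π) ×
(0, 1) (`kernel_unfold`), so the integral unfolds to `∫ φ · D` over this domain, with `D` the
twisted periodization of the density. Elements of `S^c` on one level realize every test function as
φ (`exists_isSc_extension`). Hence `D = 0` almost everywhere, and the integral for `T` vanishes too.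
The kernel of `T` never has to be smoothed or approximated. -/

/-- An operator lies in the weak operator closure of a subspace as soon as it is annihilated by
all finite sums of matrix coefficients that annihilate the subspace. -/
theorem ofCLM_mem_closure_of_forall_sum_inner [CompleteSpace E] (S : Submodule ℂ (E →L[ℂ] E))
    (T : E →L[ℂ] E)
    (h : ∀ (ι : Type u) [Fintype ι] (ξ η : ι → E),
      (∀ A ∈ S, ∑ i, inner ℂ (η i) (A (ξ i)) = 0) → ∑ i, inner ℂ (η i) (T (ξ i)) = 0) :
    ContinuousLinearMapWOT.ofCLM T ∈
      closure (ContinuousLinearMapWOT.ofCLM '' (S : Set (E →L[ℂ] E))) := by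
  classical
  rw [ContinuousLinearMapWOT.isInducing_inducingFn.closure_eq_preimage_closure_image,
    Set.mem_preimage, mem_closure_iff_nhds]
  intro s hs
  rw [nhds_pi, Filter.mem_pi] at hs
  obtain ⟨I, hI, t, ht, hts⟩ := hs
  have := hI.fintype
  -- The basic neighbourhood only sees the finitely many coefficients in `I`. In `I → ℂ` every
  -- subspace is cut out by functionals, so an element of `S` can match `T` on `I` exactly.
  let ℓ : (E →L[ℂ] E) →ₗ[ℂ] (I → ℂ) :=
    { toFun := fun A i => i.1.2 (A i.1.1)
      map_add' := fun A B => by ext; simp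
      map_smul' := fun a A => by ext; simp }
  have key : ℓ T ∈ S.map ℓ := by
    by_contra hn
    obtain ⟨f, hf, hle⟩ := Submodule.exists_le_ker_of_notMem hn
    have hfe : ∀ v : I → ℂ, f v = ∑ i, v i * f (Pi.single i 1) := fun v => by
      rw [LinearMap.pi_apply_eq_sum_univ f v]
      refine Finset.sum_congr rfl fun i _ => ?_
      rw [smul_eq_mul]
      congr 2
      ext j
      simp [Pi.single_apply, eq_comm]
    have hfA : ∀ A : E →L[ℂ] E, f (ℓ A) = ∑ i : I, inner ℂ
        ((starRingEnd ℂ) (f (Pi.single i 1)) • (InnerProductSpace.toDual ℂ E).symm i.1.2)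
        (A i.1.1) := fun A => by
      rw [hfe]
      refine Finset.sum_congr rfl fun i _ => ?_
      rw [inner_smul_left, InnerProductSpace.toDual_symm_apply, Complex.conj_conj, mul_comm]
      rfl
    refine hf ?_
    rw [hfA]
    refine h I _ _ fun A hA => ?_
    rw [← hfA]
    exact hle (Submodule.mem_map_of_mem hA)
  obtain ⟨A, hA, hAT⟩ := key
  refine ⟨_, hts fun i hi => ?_, Set.mem_image_of_mem _ (Set.mem_image_of_mem _ hA)⟩
  have h1 : i.2 (A i.1) = i.2 (T i.1) := congrFun hAT ⟨i, hi⟩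
  have h2 := mem_of_mem_nhds (ht i)
  change i.2 (A i.1) ∈ t i
  rw [h1]
  exact h2

/-- Commutation is tested by `y (A (B x)) = (y ∘ B) (A x)`, and for fixed `x`, `y` both sides are
single matrix coefficients of `A`. -/
theorem isClosed_setOf_commute (B : E →L[ℂ] E) :
    IsClosed {A : E →WOT[ℂ] E | Commute A.toCLM B} := by
  have : {A : E →WOT[ℂ] E | Commute A.toCLM B} = ⋂ (x : E) (y : StrongDual ℂ E),
      {A : E →WOT[ℂ] E | y (A (B x)) = (y ∘L B) (A x)} := by
    ext A
    simp only [Set.mem_ofPred_eq, Set.mem_iInter]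
    refine ⟨fun h x y => ?_, fun h => ?_⟩
    · have := congrArg y (DFunLike.congr_fun h.eq x)
      simpa using this
    · ext x
      refine (SeparatingDual.eq_iff_forall_dual_eq (R := ℂ)).mpr fun y => ?_
      simpa using h x y
  rw [this]
  exact isClosed_iInter fun x => isClosed_iInter fun y => isClosed_eq
    (ContinuousLinearMapWOT.continuous_dual_apply _ _)
    (ContinuousLinearMapWOT.continuous_dual_apply _ _)

end WeakOperatorTopology

theorem mem_N_commute {c : ℕ} {ħ μ ν : ℝ} {T B : H →L[ℂ] H} (hT : T ∈ N c ħ μ ν)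
    (hB : ∀ A : H →L[ℂ] H, (∃ Φ, IsSc c Φ ∧ ActsBy ħ μ ν Φ A) → Commute A B) : Commute T B := by
  have := closure_minimal (t := {A : H →WOT[ℂ] H | Commute A.toCLM B})
    (Set.image_subset_iff.mpr fun A hA => hB A hA) (isClosed_setOf_commute B) hT
  exact this

/-! ### Dominated convergence in `L²` -/

theorem tendsto_Lp_two_of_dominated {α ι : Type*} {m : MeasurableSpace α} {μ : Measure α}
    {l : Filter ι} [l.IsCountablyGenerated] (F : ι → Lp ℂ 2 μ) (f g : Lp ℂ 2 μ)
    (hb : ∀ i, ∀ᵐ z ∂μ, ‖F i z‖ ≤ ‖g z‖)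
    (hlim : ∀ᵐ z ∂μ, Tendsto (fun i => F i z) l (𝓝 (f z))) :
    Tendsto F l (𝓝 f) := by
  rcases l.eq_or_neBot with rfl | hl
  · exact tendsto_bot
  have hg : ∫⁻ z, ‖g z‖ₑ ^ 2 ∂μ ≠ ∞ := by
    have h2 := (eLpNorm_lt_top_iff_lintegral_rpow_enorm_lt_top (f := g) (μ := μ)
      (p := 2) two_ne_zero ENNReal.ofNat_ne_top).mp (Lp.memLp g).2
    simpa using h2.ne
  -- The bounds hold off null sets depending on `i`; along a sequence these are countably many, so
  -- the limit inherits the bound almost everywhere.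
  obtain ⟨u, hu⟩ := l.exists_seq_tendsto
  have hfg : ∀ᵐ z ∂μ, ‖f z‖ ≤ ‖g z‖ := by
    filter_upwards [hlim, ae_all_iff.mpr fun n => hb (u n)] with z h1 h2
    exact le_of_tendsto (h1.comp hu).norm (.of_forall h2)
  rw [Lp.tendsto_Lp_iff_tendsto_eLpNorm']
  have hlin : Tendsto (fun i => ∫⁻ z, ‖F i z - f z‖ₑ ^ 2 ∂μ) l (𝓝 0) := by
    have := tendsto_lintegral_filter_of_dominated_convergence (μ := μ) (l := l)
      (F := fun i z => ‖F i z - f z‖ₑ ^ 2) (f := fun _ => 0)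
      (fun z => 4 * ‖g z‖ₑ ^ 2)
      (.of_forall fun i => (((Lp.stronglyMeasurable _).sub
        (Lp.stronglyMeasurable _)).measurable.enorm).pow_const 2)
      (.of_forall fun i => ?_) ?_ ?_
    · simpa using this
    · filter_upwards [hb i, hfg] with z h1 h2
      have h4 : ‖F i z - f z‖ₑ ≤ 2 * ‖g z‖ₑ := by
        rw [two_mul]
        refine enorm_sub_le.trans (add_le_add ?_ ?_)
        · exact enorm_le_iff_norm_le.mpr h1
        · exact enorm_le_iff_norm_le.mpr h2
      calc _ ≤ (2 * ‖g z‖ₑ) ^ 2 := pow_le_pow_left' h4 2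
        _ = _ := by rw [mul_pow]; norm_num
    · rw [lintegral_const_mul' _ _ (by norm_num)]
      exact ENNReal.mul_ne_top (by norm_num) hg
    · filter_upwards [hlim] with z hz
      have h1 : Tendsto (fun i => F i z - f z) l (𝓝 0) := by simpa using hz.sub_const (f z)
      have h2 := (ENNReal.continuous_pow 2).tendsto 0 |>.comp
        ((continuous_enorm.tendsto (0 : ℂ)).comp h1 |>.trans (by simp))
      simpa [Function.comp_def] using h2
  have h2 := hlin.ennrpow_const (1 / 2 : ℝ)
  rw [ENNReal.zero_rpow_of_pos (by norm_num)] at h2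
  refine h2.congr fun i => ?_
  rw [eLpNorm_eq_lintegral_rpow_enorm_toReal two_ne_zero ENNReal.ofNat_ne_top]
  simp

/-! ### Uniqueness of Fourier coefficients -/

/-- The zero family is summable, so the Fourier series converges pointwise to `f`. -/
theorem eq_zero_of_fourierCoeff_eq_zero (f : UnitAddCircle → ℂ) (hf : Continuous f)
    (h : ∀ n, fourierCoeff f n = 0) (θ : UnitAddCircle) : f θ = 0 := by
  have := has_pointwise_sum_fourier_series_of_summable (f := ⟨f, hf⟩) (by
    have : fourierCoeff (⟨f, hf⟩ : C(UnitAddCircle, ℂ)) = 0 := funext h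
    rw [this]; exact summable_zero) θ
  simp only [ContinuousMap.coe_mk, h, zero_smul] at this
  exact this.unique hasSum_zero

/-! ### The space `S^c` -/

theorem contDiff_deriv_snd {F : ℝ × ℝ → ℂ} (hF : ContDiff ℝ (⊤ : ℕ∞) F) :
    ContDiff ℝ (⊤ : ℕ∞) fun w : ℝ × ℝ => deriv (fun y => F (w.1, y)) w.2 := by
  have h : (fun w : ℝ × ℝ => deriv (fun y => F (w.1, y)) w.2) =
      fun w => fderiv ℝ F w (0, 1) := by
    funext w
    have h1 : HasFDerivAt F (fderiv ℝ F w) (w.1, w.2) :=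
      (hF.differentiable (by simp) w).hasFDerivAt
    exact (h1.comp_hasDerivAt w.2 ((hasDerivAt_const w.2 w.1).prodMk (hasDerivAt_id w.2))).deriv
  rw [h]
  exact (hF.fderiv_right (m := (⊤ : ℕ∞)) (by simp)).clm_apply contDiff_const

theorem contDiff_deriv_fst {F : ℝ × ℝ → ℂ} (hF : ContDiff ℝ (⊤ : ℕ∞) F) :
    ContDiff ℝ (⊤ : ℕ∞) fun w : ℝ × ℝ => deriv (fun x => F (x, w.2)) w.1 := by
  have h : (fun w : ℝ × ℝ => deriv (fun x => F (x, w.2)) w.1) =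
      fun w => fderiv ℝ F w (1, 0) := by
    funext w
    have h1 : HasFDerivAt F (fderiv ℝ F w) (w.1, w.2) :=
      (hF.differentiable (by simp) w).hasFDerivAt
    exact (h1.comp_hasDerivAt w.1 ((hasDerivAt_id w.1).prodMk (hasDerivAt_const w.1 w.2))).deriv
  rw [h]
  exact (hF.fderiv_right (m := (⊤ : ℕ∞)) (by simp)).clm_apply contDiff_const

theorem contDiff_iteratedDeriv_snd {F : ℝ × ℝ → ℂ} (hF : ContDiff ℝ (⊤ : ℕ∞) F) (n : ℕ) :
    ContDiff ℝ (⊤ : ℕ∞) fun w : ℝ × ℝ => iteratedDeriv n (fun y => F (w.1, y)) w.2 := by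
  induction n with
  | zero => simpa using hF
  | succ n ih => simpa only [iteratedDeriv_succ] using contDiff_deriv_snd ih

theorem contDiff_iteratedDeriv_fst {F : ℝ × ℝ → ℂ} (hF : ContDiff ℝ (⊤ : ℕ∞) F) (n : ℕ) :
    ContDiff ℝ (⊤ : ℕ∞) fun w : ℝ × ℝ => iteratedDeriv n (fun x => F (x, w.2)) w.1 := by
  induction n with
  | zero => simpa using hF
  | succ n ih => simpa only [iteratedDeriv_succ] using contDiff_deriv_fst ih

theorem contDiff_partialDeriv {Φ : G → ℂ} {p : ℤ}
    (h : ContDiff ℝ (⊤ : ℕ∞) fun w : ℝ × ℝ => Φ (w.1, (w.2 : UnitAddCircle), p)) (m n : ℕ) :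
    ContDiff ℝ (⊤ : ℕ∞) fun w : ℝ × ℝ => partialDeriv m n Φ w.1 w.2 p :=
  contDiff_iteratedDeriv_fst (contDiff_iteratedDeriv_snd h n) m

theorem partialDeriv_add {Φ Ψ : G → ℂ} {p : ℤ}
    (hΦ : ContDiff ℝ (⊤ : ℕ∞) fun w : ℝ × ℝ => Φ (w.1, (w.2 : UnitAddCircle), p))
    (hΨ : ContDiff ℝ (⊤ : ℕ∞) fun w : ℝ × ℝ => Ψ (w.1, (w.2 : UnitAddCircle), p))
    (m n : ℕ) (x y : ℝ) :
    partialDeriv m n (Φ + Ψ) x y p = partialDeriv m n Φ x y p + partialDeriv m n Ψ x y p := by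
  have hsec : ∀ {F : ℝ × ℝ → ℂ}, ContDiff ℝ (⊤ : ℕ∞) F → ∀ (k : ℕ) (x' : ℝ),
      ContDiff ℝ k fun y' => F (x', y') := fun hF k x' =>
    (hF.of_le (by exact_mod_cast le_top)).comp (contDiff_const.prodMk contDiff_id)
  have hsec' : ∀ {F : ℝ × ℝ → ℂ}, ContDiff ℝ (⊤ : ℕ∞) F → ∀ (k : ℕ),
      ContDiff ℝ k fun x' => F (x', y) := fun hF k =>
    (hF.of_le (by exact_mod_cast le_top)).comp (contDiff_id.prodMk contDiff_const)
  simp only [partialDeriv, Pi.add_apply]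
  have : ∀ x' : ℝ, iteratedDeriv n (fun y' : ℝ => Φ (x', (y' : UnitAddCircle), p) +
      Ψ (x', (y' : UnitAddCircle), p)) y =
      iteratedDeriv n (fun y' : ℝ => Φ (x', (y' : UnitAddCircle), p)) y +
      iteratedDeriv n (fun y' : ℝ => Ψ (x', (y' : UnitAddCircle), p)) y := fun x' =>
    iteratedDeriv_fun_add (hsec hΦ n x').contDiffAt (hsec hΨ n x').contDiffAt
  simp_rw [this]
  exact iteratedDeriv_fun_add (hsec' (contDiff_iteratedDeriv_snd hΦ n) m).contDiffAt
    (hsec' (contDiff_iteratedDeriv_snd hΨ n) m).contDiffAt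

theorem partialDeriv_const_smul (a : ℂ) (Φ : G → ℂ) (m n : ℕ) (x y : ℝ) (p : ℤ) :
    partialDeriv m n (a • Φ) x y p = a * partialDeriv m n Φ x y p := by
  simp only [partialDeriv, Pi.smul_apply, smul_eq_mul, iteratedDeriv_const_mul_field]

theorem IsSc.add {c : ℕ} {Φ Ψ : G → ℂ} (hΦ : IsSc c Φ) (hΨ : IsSc c Ψ) : IsSc c (Φ + Ψ) where
  smooth p := (hΦ.smooth p).add (hΨ.smooth p)
  twisted m x y p := by
    simp only [Pi.add_apply, hΦ.twisted, hΨ.twisted, mul_add]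
  bounded P m n C hC := by
    obtain ⟨B, hB⟩ := hΦ.bounded P m n C hC
    obtain ⟨B', hB'⟩ := hΨ.bounded P m n C hC
    refine ⟨B + B', fun x y p h => ?_⟩
    rw [partialDeriv_add (hΦ.smooth p) (hΨ.smooth p), mul_add]
    exact (norm_add_le _ _).trans (add_le_add (hB x y p h) (hB' x y p h))

theorem IsSc.const_smul {c : ℕ} {Φ : G → ℂ} (hΦ : IsSc c Φ) (a : ℂ) : IsSc c (a • Φ) where
  smooth p := contDiff_const.mul (hΦ.smooth p)
  twisted m x y p := by
    simp only [Pi.smul_apply, hΦ.twisted, smul_eq_mul]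
    ring
  bounded P m n C hC := by
    obtain ⟨B, hB⟩ := hΦ.bounded P m n C hC
    refine ⟨‖a‖ * B, fun x y p h => ?_⟩
    rw [partialDeriv_const_smul, mul_left_comm, norm_mul]
    exact mul_le_mul_of_nonneg_left (hB x y p h) (norm_nonneg a)

theorem partialDeriv_sub_intCast (Φ : G → ℂ) (m n : ℕ) (x y : ℝ) (p k : ℤ) :
    partialDeriv m n Φ x (y - k) p = partialDeriv m n Φ x y p := by
  simp only [partialDeriv]
  congr 1
  funext x'
  have := congrFun (iteratedDeriv_comp_sub_const n
    (fun y' : ℝ => Φ (x', (y' : UnitAddCircle), p)) (k : ℝ)) y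
  rw [← this]
  have hk : ((k : ℝ) : UnitAddCircle) = 0 := by
    rw [AddCircle.coe_eq_zero_iff]; exact ⟨k, by simp⟩
  simp [hk]

/-- A smooth twisted function supported on a single level `ℝ × 𝕋 × {s}` belongs to `S^c`. -/
theorem isSc_of_level {c : ℕ} {Φ : G → ℂ} (s : ℤ)
    (hs : ∀ x y p, p ≠ s → Φ (x, y, p) = 0)
    (hsm : ContDiff ℝ (⊤ : ℕ∞) fun w : ℝ × ℝ => Φ (w.1, (w.2 : UnitAddCircle), s))
    (htw : ∀ (m : ℤ) (x y : ℝ), Φ (x + 2 * Real.pi * m, (y : UnitAddCircle), s) =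
      Complex.exp (Complex.I * c * (2 * Real.pi * m) * s * y) *
        Φ (x, (y : UnitAddCircle), s)) : IsSc c Φ where
  smooth p := by
    by_cases hp : p = s
    · exact hp ▸ hsm
    · simpa only [hs _ _ p hp] using contDiff_const
  twisted m x y p := by
    by_cases hp : p = s
    · exact hp ▸ htw m x y
    · simp [hs _ _ p hp]
  bounded P m n C hC := by
    -- With a single nonzero level the decay in `p` is free and compactness gives the bound. This
    -- compact subset of the universal cover contains a lift of every point of `C`.
    have hK : IsCompact ((Prod.fst '' C) ×ˢ Set.Icc (0 : ℝ) 1) :=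
      (hC.image continuous_fst).prod isCompact_Icc
    obtain ⟨B, hB⟩ := hK.exists_bound_of_continuousOn
      (f := fun w : ℝ × ℝ => P.eval (s : ℂ) * partialDeriv m n Φ w.1 w.2 s)
      (continuous_const.mul (contDiff_partialDeriv hsm m n).continuous).continuousOn
    refine ⟨max B 0, fun x y p hxy => ?_⟩
    by_cases hp : p = s
    · subst hp
      have := hB (x, y - ⌊y⌋) ⟨⟨_, hxy, rfl⟩, ?_⟩
      · rw [partialDeriv_sub_intCast] at this
        exact this.trans (le_max_left _ _)
      · exact ⟨Int.fract_nonneg y, (Int.fract_lt_one y).le⟩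
    · have : partialDeriv m n Φ x y p = 0 := by
        simp only [partialDeriv, hs _ _ p hp]
        simp
      simp [this]

theorem isSc_zero (c : ℕ) : IsSc c 0 :=
  isSc_of_level 0 (by simp) (by simpa using contDiff_const) (by simp)

/-- The operators given by `S^c` form a subspace of `B(H)`. -/
def scOps (c : ℕ) (ħ μ ν : ℝ) : Submodule ℂ (H →L[ℂ] H) where
  carrier := {A : H →L[ℂ] H | ∃ Φ, IsSc c Φ ∧ ActsBy ħ μ ν Φ A}
  zero_mem' := ⟨0, isSc_zero c, fun ξ => by
    filter_upwards [Lp.coeFn_zero ℂ 2 haar] with z hz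
    simp only [Pi.zero_apply, zero_mul, _root_.zero_apply]
    rw [hz]
    exact hasSum_zero⟩
  add_mem' := by
    rintro A B ⟨Φ, hΦ, hA⟩ ⟨Ψ, hΨ, hB⟩
    refine ⟨Φ + Ψ, hΦ.add hΨ, fun ξ => ?_⟩
    filter_upwards [hA ξ, hB ξ, Lp.coeFn_add (A ξ) (B ξ)] with z h1 h2 h3
    simp only [Pi.add_apply, add_mul, _root_.add_apply]
    rw [h3]
    exact h1.add h2
  smul_mem' := by
    rintro a A ⟨Φ, hΦ, hA⟩
    refine ⟨a • Φ, hΦ.const_smul a, fun ξ => ?_⟩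
    filter_upwards [hA ξ, Lp.coeFn_smul a (A ξ)] with z h1 h3
    rw [_root_.smul_apply, h3]
    simpa only [Pi.smul_apply, smul_eq_mul, mul_assoc] using h1.mul_left a

/-! ### Periodization of test functions -/

/-- The twisted periodization of a function on the plane. -/
def periodize (c : ℕ) (s : ℤ) (ψ : ℝ × ℝ → ℝ) (w : ℝ × ℝ) : ℂ :=
  ∑ᶠ k : ℤ × ℤ, Complex.exp (Complex.I * c * (2 * Real.pi * k.1) * s * w.2) *
    ψ (w.1 - 2 * Real.pi * k.1, w.2 - k.2)

/-- If the support lies in a ball of radius `R`, only translates with |2πm|, |n| ≤ ‖w₀‖ + 1 + R meet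
the unit ball at `w₀`. The factor `e` can only shrink supports. -/
theorem locallyFinite_support_translates {ψ : ℝ × ℝ → ℝ} (hψ : HasCompactSupport ψ)
    (e : ℤ × ℤ → ℝ × ℝ → ℂ) :
    LocallyFinite fun k : ℤ × ℤ => Function.support fun w : ℝ × ℝ =>
      e k w * ψ (w.1 - 2 * Real.pi * k.1, w.2 - k.2) := by
  obtain ⟨R, hR⟩ := hψ.isCompact.isBounded.subset_closedBall (0 : ℝ × ℝ)
  intro w₀
  refine ⟨Metric.ball w₀ 1, Metric.ball_mem_nhds _ one_pos, ?_⟩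
  set L : ℝ := ‖w₀‖ + 1 + R
  refine ((Set.finite_Icc (-⌈L⌉) ⌈L⌉).prod (Set.finite_Icc (-⌈L⌉) ⌈L⌉)).subset ?_
  rintro ⟨m, n⟩ ⟨w, hw, hwb⟩
  have h0 : ψ (w.1 - 2 * Real.pi * m, w.2 - n) ≠ 0 := fun h => hw (by simp [h])
  have h1 := hR (subset_tsupport ψ h0)
  rw [mem_closedBall_zero_iff, Prod.norm_def, max_le_iff] at h1
  have h2 : ‖w‖ ≤ ‖w₀‖ + 1 := by
    have h3 : ‖w - w₀‖ < 1 := by rwa [← dist_eq_norm]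
    have h4 := norm_le_norm_add_norm_sub' w w₀
    linarith
  rw [Prod.norm_def, max_le_iff] at h2
  simp only [Real.norm_eq_abs, abs_le] at h1 h2
  have hL : L ≤ ⌈L⌉ := Int.le_ceil L
  have hp : (1 : ℝ) ≤ 2 * Real.pi := by linarith [Real.pi_gt_three]
  have hm1 : (m : ℝ) * (2 * Real.pi) ≤ L := by simp only [L]; linarith
  have hm2 : -L ≤ (m : ℝ) * (2 * Real.pi) := by simp only [L]; linarith
  have hL0 : 0 ≤ L := by
    simp only [L]
    linarith [norm_nonneg w₀, h1.2]
  have key : ∀ a : ℤ, (a : ℝ) ≤ L → -L ≤ a → a ∈ Set.Icc (-⌈L⌉) ⌈L⌉ := fun a ha hb =>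
    ⟨by exact_mod_cast (show (-⌈L⌉ : ℝ) ≤ a by linarith),
      by exact_mod_cast (show (a : ℝ) ≤ ⌈L⌉ by linarith)⟩
  refine ⟨key m ?_ ?_, key n ?_ ?_⟩
  · by_contra! h; nlinarith
  · by_contra! h; nlinarith
  · simp only [L]; linarith
  · simp only [L]; linarith

theorem contDiff_periodize (c : ℕ) (s : ℤ) {ψ : ℝ × ℝ → ℝ} (hs : ContDiff ℝ (⊤ : ℕ∞) ψ)
    (hψ : HasCompactSupport ψ) : ContDiff ℝ (⊤ : ℕ∞) (periodize c s ψ) := by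
  rw [← contMDiff_iff_contDiff]
  refine contMDiff_finsum (fun k => ?_) (locallyFinite_support_translates hψ _)
  rw [contMDiff_iff_contDiff]
  refine ContDiff.mul ?_ (Complex.ofRealCLM.contDiff.comp (hs.comp (by fun_prop)))
  exact (contDiff_const.mul (Complex.ofRealCLM.contDiff.comp contDiff_snd)).cexp

theorem periodize_add_two_pi (c : ℕ) (s : ℤ) (ψ : ℝ × ℝ → ℝ) (m : ℤ) (x y : ℝ) :
    periodize c s ψ (x + 2 * Real.pi * m, y) =
      Complex.exp (Complex.I * c * (2 * Real.pi * m) * s * y) * periodize c s ψ (x, y) := by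
  unfold periodize
  rw [← smul_eq_mul (Complex.exp _) (finsum _), smul_finsum,
    ← finsum_comp_equiv (Equiv.addRight ((m, 0) : ℤ × ℤ))]
  refine finsum_congr fun k => ?_
  simp only [Equiv.coe_addRight, Prod.fst_add, Prod.snd_add, add_zero, smul_eq_mul]
  rw [← mul_assoc (Complex.exp _), ← Complex.exp_add]
  congr 2
  · push_cast; ring
  · congr 2; push_cast; ring_nf

theorem periodize_periodic (c : ℕ) (s : ℤ) (ψ : ℝ × ℝ → ℝ) (x : ℝ) :
    Function.Periodic (fun y => periodize c s ψ (x, y)) 1 := by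
  intro y
  simp only [periodize]
  rw [← finsum_comp_equiv (Equiv.addRight ((0, 1) : ℤ × ℤ))]
  refine finsum_congr fun k => ?_
  simp only [Equiv.coe_addRight, Prod.fst_add, Prod.snd_add, add_zero]
  congr 1
  -- The shift `y + 1` changes the exponent by 2πi · c k₁ s; integrality of `c` enters here.
  · rw [Complex.exp_eq_exp_iff_exists_int]
    exact ⟨c * k.1 * s, by push_cast; ring⟩
  · congr 2; push_cast; ring_nf

theorem periodize_eq (c : ℕ) (s : ℤ) {ψ : ℝ × ℝ → ℝ}
    (hψ : tsupport ψ ⊆ Set.Ioo 0 (2 * Real.pi) ×ˢ Set.Ioo 0 1) {w : ℝ × ℝ}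
    (hw : w ∈ Set.Ioo 0 (2 * Real.pi) ×ˢ Set.Ioo (0 : ℝ) 1) : periodize c s ψ w = ψ w := by
  unfold periodize
  rw [finsum_eq_single _ (0, 0)]
  · simp
  · rintro ⟨m, n⟩ hk
    suffices h : ψ (w.1 - 2 * Real.pi * m, w.2 - n) = 0 by simp [h]
    by_contra h
    have h1 := hψ (subset_tsupport ψ h)
    simp only [Set.mem_prod, Set.mem_Ioo] at h1 hw
    have hpi := Real.pi_pos
    refine hk (Prod.ext ?_ ?_)
    · have ha : (-1 : ℝ) < m := by nlinarith
      have hb : (m : ℝ) < 1 := by nlinarith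
      have ha' : -1 < m := by exact_mod_cast ha
      have hb' : m < 1 := by exact_mod_cast hb
      exact (by omega : m = 0)
    · have ha : (-1 : ℝ) < n := by linarith
      have hb : (n : ℝ) < 1 := by linarith
      have ha' : -1 < n := by exact_mod_cast ha
      have hb' : n < 1 := by exact_mod_cast hb
      exact (by omega : n = 0)

/-- Every test function supported in the fundamental domain `(0, 2π) × (0, 1)` extends to an
element of `S^c` supported on a prescribed level. -/
theorem exists_isSc_extension (c : ℕ) (s : ℤ) {ψ : ℝ × ℝ → ℝ} (hs : ContDiff ℝ (⊤ : ℕ∞) ψ)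
    (hc : HasCompactSupport ψ) (hψ : tsupport ψ ⊆ Set.Ioo 0 (2 * Real.pi) ×ˢ Set.Ioo 0 1) :
    ∃ Φ : G → ℂ, IsSc c Φ ∧ (∀ x y p, p ≠ s → Φ (x, y, p) = 0) ∧
      ∀ x y : ℝ, (x, y) ∈ Set.Ioo 0 (2 * Real.pi) ×ˢ Set.Ioo (0 : ℝ) 1 →
        Φ (x, (y : UnitAddCircle), s) = ψ (x, y) := by
  let Φ : G → ℂ := fun z => if z.2.2 = s then (periodize_periodic c s ψ z.1).lift z.2.1 else 0
  have hΦ : ∀ x y : ℝ, Φ (x, (y : UnitAddCircle), s) = periodize c s ψ (x, y) := fun x y => by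
    simp only [Φ, if_true]
    exact Function.Periodic.lift_coe _ y
  have h0 : ∀ x y p, p ≠ s → Φ (x, y, p) = 0 := fun x y p hp => by simp [Φ, hp]
  refine ⟨Φ, isSc_of_level s h0 ?_ fun m x y => ?_, h0, fun x y hxy => ?_⟩
  · simp only [hΦ]
    exact contDiff_periodize c s hs hc
  · rw [hΦ, hΦ, periodize_add_two_pi]
  · rw [hΦ, periodize_eq c s hψ hxy]

/-! ### The operators of `S^c` commute with `V`, `W` and `X` -/

theorem ae_add_right {Q : G → Prop} (h : ∀ᵐ z ∂haar, Q z) (a : G) : ∀ᵐ z ∂haar, Q (z + a) :=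
  (measurePreserving_add_right haar a).quasiMeasurePreserving.ae h

/-- Level shifts preserve `haar` and are countable in number. This allows an almost-everywhere
identity inside the sum over `q`, which samples all levels over the same (x, y). -/
theorem ae_forall_level {Q : G → Prop} (h : ∀ᵐ z ∂haar, Q z) :
    ∀ᵐ z ∂haar, ∀ j : ℤ, Q (z.1, z.2.1, j) := by
  filter_upwards [ae_all_iff.mpr fun r : ℤ => ae_add_right h (0, 0, r)] with z hz j
  simpa [Prod.add_def] using hz (j - z.2.2)

theorem ActsBy.commute_V {ħ μ ν : ℝ} {Φ : G → ℂ} {A : H →L[ℂ] H} (hA : ActsBy ħ μ ν Φ A)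
    (f : Lp ℂ ∞ haarRT) : Commute A (V f) := by
  ext1 ξ
  refine Lp.ext ?_
  change A (V f ξ) =ᵐ[haar] V f (A ξ)
  filter_upwards [hA ξ, hA (V f ξ), ae_forall_level (V_ae f ξ), V_ae f (A ξ)] with z h1 h2 h3 h4
  rw [h4]
  refine h2.unique ?_
  simp only [h3]
  refine HasSum.congr_fun (h1.mul_left (f (z.1, z.2.1))) fun q => ?_
  ring

/-- Completing the square: with k = 2πm, the twist at the displaced point has exponent ick(qy −
ħν(q² − 2pq)), and p² + q² − 2pq = (p − q)². This forces the quadratic term in the phase of `W`. -/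
theorem phase_mul_kernel {c : ℕ} {Φ : G → ℂ} (hΦ : IsSc c Φ) (ħ μ ν : ℝ) (m : ℤ) (x : ℝ)
    (y : UnitAddCircle) (p q : ℤ) :
    phase c ħ ν m (x, y, p) * Φ (x + 2 * Real.pi * m - ħ * (q - 2 * p) * μ,
        y - ((ħ * (q - 2 * p) * ν : ℝ) : UnitAddCircle), q) =
      phase c ħ ν m (x, y, p - q) * Φ (x - ħ * (q - 2 * p) * μ,
        y - ((ħ * (q - 2 * p) * ν : ℝ) : UnitAddCircle), q) := by
  induction y using QuotientAddGroup.induction_on with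
  | H y =>
    have h := hΦ.twisted m (x - ħ * (q - 2 * p) * μ) (y - ħ * (q - 2 * p) * ν) q
    have e1 := phase_coe c ħ ν m x y p
    have e2 := phase_coe c ħ ν m x y (p - q)
    rw [AddCircle.coe_sub, show x - ħ * (q - 2 * p) * μ + 2 * Real.pi * m =
      x + 2 * Real.pi * m - ħ * (q - 2 * p) * μ by ring] at h
    change phase c ħ ν m (x, (y : UnitAddCircle), p) * Φ (x + 2 * Real.pi * m -
        ħ * (q - 2 * p) * μ, (y : UnitAddCircle) - _, q) =
      phase c ħ ν m (x, (y : UnitAddCircle), p - q) * Φ (x - ħ * (q - 2 * p) * μ,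
        (y : UnitAddCircle) - _, q)
    rw [h, e1, e2, ← mul_assoc, ← Complex.exp_add]
    congr 2
    push_cast
    ring

theorem ActsBy.commute_W {c : ℕ} {ħ μ ν : ℝ} {Φ : G → ℂ} {A : H →L[ℂ] H} (hΦ : IsSc c Φ)
    (hA : ActsBy ħ μ ν Φ A) (m : ℤ) : Commute A (W c ħ ν m) := by
  ext1 ξ
  refine Lp.ext ?_
  change A (W c ħ ν m ξ) =ᵐ[haar] W c ħ ν m (A ξ)
  filter_upwards [ae_add_right (hA ξ) (2 * Real.pi * m, 0, 0), hA (W c ħ ν m ξ),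
    ae_forall_level (W_ae c ħ ν m ξ), W_ae c ħ ν m (A ξ)] with z h1 h2 h3 h4
  rw [h4]
  refine h2.unique ?_
  simp only [h3]
  obtain ⟨x, y, p⟩ := z
  simp only [Prod.mk_add_mk, add_zero] at h1 ⊢
  refine HasSum.congr_fun (h1.mul_left (phase c ħ ν m (x, y, p))) fun q => ?_
  rw [← mul_assoc, ← mul_assoc, phase_mul_kernel hΦ, mul_comm (Φ _)]

/-- The translation by −2ħr(μ, ν) compensates the change of `q - 2 * p` under p ↦ p + r. -/
theorem ActsBy.commute_X {ħ μ ν : ℝ} {Φ : G → ℂ} {A : H →L[ℂ] H} (hA : ActsBy ħ μ ν Φ A)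
    (r : ℤ) : Commute A (X ħ μ ν r) := by
  ext1 ξ
  refine Lp.ext ?_
  change A (X ħ μ ν r ξ) =ᵐ[haar] X ħ μ ν r (A ξ)
  filter_upwards [ae_add_right (hA ξ)
    (-(2 * ħ * r * μ), ((-(2 * ħ * r * ν) : ℝ) : UnitAddCircle), r), hA (X ħ μ ν r ξ),
    ae_forall_level (X_ae ħ μ ν r ξ), X_ae ħ μ ν r (A ξ)] with z h1 h2 h3 h4
  rw [h4]
  refine h2.unique ?_
  simp only [h3]
  obtain ⟨x, y, p⟩ := z
  simp only [Prod.mk_add_mk, AddCircle.coe_neg, ← sub_eq_add_neg] at h1 ⊢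
  refine HasSum.congr_fun h1 fun q => ?_
  rw [sub_sub y, ← AddCircle.coe_add,
    show 2 * ħ * r * ν + ħ * (q - 2 * (p + r : ℤ)) * ν = ħ * (q - 2 * p) * ν by push_cast; ring,
    show x - 2 * ħ * r * μ - ħ * (q - 2 * (p + r : ℤ)) * μ = x - ħ * (q - 2 * p) * μ by
      push_cast; ring, show p - q + r = p + r - q by ring]

theorem commute_of_mem_N {c : ℕ} {ħ μ ν : ℝ} {T : H →L[ℂ] H} (hT : T ∈ N c ħ μ ν) :
    (∀ f : Lp ℂ ∞ haarRT, Commute T (V f)) ∧ (∀ m : ℤ, Commute T (W c ħ ν m)) ∧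
      (∀ r : ℤ, Commute T (X ħ μ ν r)) :=
  ⟨fun f => mem_N_commute hT fun _ ⟨_, _, hA⟩ => hA.commute_V f,
    fun m => mem_N_commute hT fun _ ⟨_, hΦ, hA⟩ => hA.commute_W hΦ m,
    fun r => mem_N_commute hT fun _ ⟨_, _, hA⟩ => hA.commute_X r⟩

/-! ### Matrix coefficients of operators commuting with `L^∞(ℝ × 𝕋)` -/

theorem memLp_levelIndicator (j : ℤ) :
    MemLp (fun z : G => if z.2.2 = j then (1 : ℂ) else 0) ∞ haar := by
  refine memLp_top_of_bound (Continuous.aestronglyMeasurable (continuous_G fun p => ?_)) 1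
    (.of_forall fun z => ?_)
  · exact continuous_const (Y := ℂ) (y := if p = j then 1 else 0)
  · split_ifs <;> simp

/-- The projection onto the functions supported on `ℝ × 𝕋 × {j}`. -/
def levelProj (j : ℤ) : H →L[ℂ] H := mulOp _ (memLp_levelIndicator j)

theorem levelProj_ae (j : ℤ) (ξ : H) :
    ∀ᵐ z ∂haar, levelProj j ξ z = if z.2.2 = j then ξ z else 0 := by
  filter_upwards [mulOp_ae _ (memLp_levelIndicator j) ξ] with z hz
  rw [levelProj, hz]
  split_ifs <;> simp

theorem ext_levelProj {ξ η : H} (h : ∀ j, levelProj j ξ = levelProj j η) : ξ = η := by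
  refine Lp.ext ?_
  filter_upwards [ae_all_iff.mpr fun j => levelProj_ae j ξ,
    ae_all_iff.mpr fun j => levelProj_ae j η] with z h1 h2
  have h3 := h1 z.2.2
  rw [h, h2, if_pos rfl, if_pos rfl] at h3
  exact h3.symm

theorem levelProj_levelProj (i j : ℤ) (ξ : H) :
    levelProj i (levelProj j ξ) = if i = j then levelProj j ξ else 0 := by
  refine Lp.ext ?_
  filter_upwards [levelProj_ae i (levelProj j ξ), levelProj_ae j ξ,
    Lp.coeFn_zero ℂ 2 haar] with z h1 h2 h3
  rw [h1, h2]
  by_cases hij : i = j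
  · subst hij
    rw [if_pos rfl, h2]
    split_ifs <;> rfl
  · rw [if_neg hij, h3]
    split_ifs with h4 h5
    · exact absurd (h4.symm.trans h5) hij
    · rfl
    · rfl

/-- The Gaussian `e^{-x²}`. -/
def gauss (x : ℝ) : ℂ := (Real.exp (-x ^ 2) : ℝ)

theorem gauss_ne_zero (x : ℝ) : gauss x ≠ 0 :=
  Complex.ofReal_ne_zero.mpr (Real.exp_pos _).ne'

theorem continuous_gauss : Continuous gauss := by
  unfold gauss
  fun_prop

/-- Constants are not square integrable on ℝ; the Gaussian is, and it vanishes nowhere, so its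
multiples by bounded functions of (x, y) are dense in the level. -/
theorem memLp_levelGauss (j : ℤ) :
    MemLp (fun z : G => if z.2.2 = j then gauss z.1 else 0) 2 haar := by
  have hm : AEStronglyMeasurable (fun z : G => if z.2.2 = j then gauss z.1 else 0) haar := by
    refine Continuous.aestronglyMeasurable (continuous_G fun p => ?_)
    by_cases hp : p = j
    · simp only [hp, if_true]
      exact continuous_gauss.comp continuous_fst
    · simpa only [hp, if_false] using continuous_const
  rw [memLp_two_iff_integrable_sq_norm hm]
  have h1 : Integrable fun x : ℝ => Real.exp (-2 * x ^ 2) := integrable_exp_neg_mul_sq two_pos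
  have h2 : Integrable (fun p : ℤ => if p = j then (1 : ℝ) else 0) Measure.count := by
    rw [integrable_count_iff]
    exact (hasSum_ite_eq j (1 : ℝ)).summable.congr fun p => by split_ifs <;> simp
  have h3 : Integrable (fun _ : UnitAddCircle => (1 : ℝ)) := integrable_const _
  refine (h1.mul_prod (h3.mul_prod h2)).congr (.of_forall fun z => ?_)
  by_cases hz : z.2.2 = j
  · simp only [hz, if_true, gauss, Complex.norm_real, Real.norm_eq_abs, sq_abs, mul_one]
    rw [← Real.exp_nat_mul]
    congr 1
    push_cast; ring
  · simp [hz]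

/-- The Gaussian on the level `j`. -/
def levelGauss (j : ℤ) : H := (memLp_levelGauss j).toLp _

theorem levelGauss_ae (j : ℤ) :
    ∀ᵐ z ∂haar, levelGauss j z = if z.2.2 = j then gauss z.1 else 0 :=
  (memLp_levelGauss j).coeFn_toLp

/-- An operator commuting with `L^∞(ℝ × 𝕋)` is determined by its values on the Gaussians. -/
theorem apply_levelProj_ae {T : H →L[ℂ] H} (hT : ∀ f : Lp ℂ ∞ haarRT, Commute T (V f)) (j : ℤ)
    (ζ : H) : ∀ᵐ z ∂haar, T (levelProj j ζ) z =
      ζ (z.1, z.2.1, j) / gauss z.1 * T (levelGauss j) z := by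
  let u : ℝ × UnitAddCircle → ℂ := fun w => ζ (w.1, w.2, j) / gauss w.1
  have hu : Measurable u :=
    ((Lp.stronglyMeasurable ζ).measurable.comp (by fun_prop)).div
      (continuous_gauss.measurable.comp measurable_fst)
  -- The quotient `u` need not be bounded, so it is truncated to give elements of L^∞; at each point
  -- the truncations are eventually equal to `u`.
  let F : ℕ → ℝ × UnitAddCircle → ℂ := fun n w => if ‖u w‖ ≤ n then u w else 0
  have hF : ∀ n, MemLp (F n) ∞ haarRT := fun n => by
    refine memLp_top_of_bound (Measurable.ite (measurableSet_le hu.norm measurable_const) hu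
      measurable_const).aestronglyMeasurable n (.of_forall fun w => ?_)
    simp only [F]
    split_ifs with h
    · exact h
    · simp
  have hV : ∀ n (ξ : H), ∀ᵐ z ∂haar, V ((hF n).toLp _) ξ z = F n (z.1, z.2.1) * ξ z := by
    intro n ξ
    filter_upwards [V_ae ((hF n).toLp _) ξ,
      quasiMeasurePreserving_proj.ae (hF n).coeFn_toLp] with z h1 h2
    rw [h1, h2]
  have hlim : ∀ w, ∀ᶠ n : ℕ in atTop, F n w = u w := fun w => by
    obtain ⟨n₀, hn₀⟩ := exists_nat_ge ‖u w‖
    filter_upwards [eventually_ge_atTop n₀] with n hn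
    exact if_pos (hn₀.trans (by exact_mod_cast hn))
  have hlevel : ∀ᵐ z ∂haar, ∀ n, V ((hF n).toLp _) (levelGauss j) z =
      F n (z.1, z.2.1) * (if z.2.2 = j then gauss z.1 else 0) := by
    filter_upwards [ae_all_iff.mpr fun n => hV n (levelGauss j), levelGauss_ae j] with z h1 h2 n
    rw [h1, h2]
  have hconv : Tendsto (fun n => V ((hF n).toLp _) (levelGauss j)) atTop
      (𝓝 (levelProj j ζ)) := by
    refine tendsto_Lp_two_of_dominated _ _ (levelProj j ζ) (fun n => ?_) ?_
    · filter_upwards [hlevel, levelProj_ae j ζ] with z h1 h2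
      rw [h1, h2]
      obtain ⟨x, y, p⟩ := z
      by_cases hp : p = j
      · subst hp
        simp only [if_true, F]
        split_ifs
        · simp only [u]
          rw [div_mul_cancel₀ _ (gauss_ne_zero x)]
        · simp
      · simp [hp]
    · filter_upwards [hlevel, levelProj_ae j ζ] with z h1 h2
      refine tendsto_const_nhds.congr' ?_
      filter_upwards [hlim (z.1, z.2.1)] with n hn
      rw [h1, h2, hn]
      obtain ⟨x, y, p⟩ := z
      by_cases hp : p = j
      · subst hp
        simp only [if_true, u]
        rw [div_mul_cancel₀ _ (gauss_ne_zero x)]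
      · simp [hp]
  have hTconv := (T.continuous.tendsto _).comp hconv
  obtain ⟨k, hk, hae⟩ := (tendstoInMeasure_of_tendsto_Lp hTconv).exists_seq_tendsto_ae
  filter_upwards [hae, ae_all_iff.mpr fun n => hV n (T (levelGauss j))] with z h1 h2
  refine tendsto_nhds_unique h1 (tendsto_const_nhds.congr' ?_)
  filter_upwards [hk.tendsto_atTop.eventually (hlim (z.1, z.2.1))] with n hn
  have hc : T (V ((hF (k n)).toLp _) (levelGauss j)) = V ((hF (k n)).toLp _) (T (levelGauss j)) :=
    DFunLike.congr_fun (hT _).eq _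
  simp only [Function.comp_apply]
  rw [hc, h2, hn]

/-- The kernel of `T` on the diagonal `q`: the entry `(p, p + q)` of the matrix of `T`. -/
def kernel (T : H →L[ℂ] H) (q : ℤ) (z : G) : ℂ := T (levelGauss (z.2.2 + q)) z / gauss z.1

/-- `X` carries the Gaussian of level j + r to a translated Gaussian on level j. Evaluating `T` on
it by commutation and by `apply_levelProj_ae` compares two matrix entries; division by `gauss`
removes the translation factor. -/
theorem kernel_X {ħ μ ν : ℝ} {T : H →L[ℂ] H} (hT : ∀ f : Lp ℂ ∞ haarRT, Commute T (V f))
    (hX : ∀ r : ℤ, Commute T (X ħ μ ν r)) (q r : ℤ) :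
    ∀ᵐ z ∂haar, kernel T q (z.1 - 2 * ħ * r * μ,
      z.2.1 - ((2 * ħ * r * ν : ℝ) : UnitAddCircle), z.2.2 + r) = kernel T q z := by
  have hsupp : ∀ j : ℤ, levelProj j (X ħ μ ν r (levelGauss (j + r))) =
      X ħ μ ν r (levelGauss (j + r)) := fun j => by
    refine Lp.ext ?_
    filter_upwards [levelProj_ae j (X ħ μ ν r (levelGauss (j + r))),
      X_ae ħ μ ν r (levelGauss (j + r)), ae_add_right (levelGauss_ae (j + r))
        (-(2 * ħ * r * μ), ((-(2 * ħ * r * ν) : ℝ) : UnitAddCircle), r)] with z h1 h2 h3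
    rw [h1]
    split_ifs with h
    · rfl
    · simp only [Prod.add_def, AddCircle.coe_neg, ← sub_eq_add_neg] at h3
      rw [h2, h3, if_neg (by simpa using h)]
  have key : ∀ j : ℤ, ∀ᵐ z ∂haar, gauss (z.1 - 2 * ħ * r * μ) / gauss z.1 * T (levelGauss j) z =
      T (levelGauss (j + r)) (z.1 - 2 * ħ * r * μ,
        z.2.1 - ((2 * ħ * r * ν : ℝ) : UnitAddCircle), z.2.2 + r) := fun j => by
    have hc : T (X ħ μ ν r (levelGauss (j + r))) = X ħ μ ν r (T (levelGauss (j + r))) :=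
      DFunLike.congr_fun (hX r).eq _
    have h0 := apply_levelProj_ae hT j (X ħ μ ν r (levelGauss (j + r)))
    rw [hsupp, hc] at h0
    filter_upwards [h0, X_ae ħ μ ν r (T (levelGauss (j + r))),
      ae_forall_level (X_ae ħ μ ν r (levelGauss (j + r))),
      ae_forall_level (ae_add_right (levelGauss_ae (j + r))
        (-(2 * ħ * r * μ), ((-(2 * ħ * r * ν) : ℝ) : UnitAddCircle), r))] with z h1 h2 h3 h4
    have h5 := h4 j
    simp only [Prod.add_def, AddCircle.coe_neg, ← sub_eq_add_neg, if_true] at h5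
    rw [← h2, h1, h3, h5]
  filter_upwards [ae_all_iff.mpr key] with z hz
  simp only [kernel]
  rw [show z.2.2 + r + q = z.2.2 + q + r by ring, ← hz]
  field_simp [gauss_ne_zero]

/-- The same comparison for `W`: the phase appears at the source level p + q on one side and at the
target level p on the other. -/
theorem kernel_W {c : ℕ} {ħ ν : ℝ} {T : H →L[ℂ] H} (hT : ∀ f : Lp ℂ ∞ haarRT, Commute T (V f))
    (hW : ∀ m : ℤ, Commute T (W c ħ ν m)) (q m : ℤ) :
    ∀ᵐ z ∂haar, phase c ħ ν m z * kernel T q (z.1 + 2 * Real.pi * m, z.2.1, z.2.2) =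
      phase c ħ ν m (z.1, z.2.1, z.2.2 + q) * kernel T q z := by
  have hsupp : ∀ j : ℤ, levelProj j (W c ħ ν m (levelGauss j)) = W c ħ ν m (levelGauss j) := by
    intro j
    refine Lp.ext ?_
    filter_upwards [levelProj_ae j (W c ħ ν m (levelGauss j)), W_ae c ħ ν m (levelGauss j),
      ae_add_right (levelGauss_ae j) (2 * Real.pi * m, 0, 0)] with z h1 h2 h3
    rw [h1]
    split_ifs with h
    · rfl
    · simp only [Prod.add_def, add_zero] at h3
      rw [h2, h3, if_neg h, mul_zero]
  have key : ∀ j : ℤ, ∀ᵐ z ∂haar, phase c ħ ν m (z.1, z.2.1, j) *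
      gauss (z.1 + 2 * Real.pi * m) / gauss z.1 * T (levelGauss j) z =
      phase c ħ ν m z * T (levelGauss j) (z.1 + 2 * Real.pi * m, z.2.1, z.2.2) := fun j => by
    have hc : T (W c ħ ν m (levelGauss j)) = W c ħ ν m (T (levelGauss j)) :=
      DFunLike.congr_fun (hW m).eq _
    have h0 := apply_levelProj_ae hT j (W c ħ ν m (levelGauss j))
    rw [hsupp, hc] at h0
    filter_upwards [h0, W_ae c ħ ν m (T (levelGauss j)),
      ae_forall_level (W_ae c ħ ν m (levelGauss j)),
      ae_forall_level (ae_add_right (levelGauss_ae j) (2 * Real.pi * m, 0, 0))] with z h1 h2 h3 h4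
    have h5 := h4 j
    simp only [Prod.add_def, add_zero, if_true] at h5
    rw [← h2, h1, h3, h5]
  filter_upwards [ae_all_iff.mpr key] with z hz
  simp only [kernel]
  rw [← mul_div_assoc, ← hz]
  field_simp [gauss_ne_zero]

/-! ### The gauge action of the circle and its Fourier components -/

theorem norm_fourier_apply (n : ℤ) (θ : UnitAddCircle) : ‖fourier n θ‖ = 1 := by
  rw [fourier_apply]
  exact Circle.norm_coe _

theorem memLp_gauge (θ : UnitAddCircle) : MemLp (fun z : G => fourier z.2.2 θ) ∞ haar := by
  refine memLp_top_of_bound (Continuous.aestronglyMeasurable (continuous_G fun p => ?_)) 1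
    (.of_forall fun z => (norm_fourier_apply _ θ).le)
  exact continuous_const (Y := ℂ) (y := fourier p θ)

/-- The gauge action `(U_θ ξ)(x, y, p) = e^{2πipθ} ξ(x, y, p)`. -/
def gauge (θ : UnitAddCircle) : H →L[ℂ] H := mulOp _ (memLp_gauge θ)

theorem gauge_ae (θ : UnitAddCircle) (ξ : H) :
    ∀ᵐ z ∂haar, gauge θ ξ z = fourier z.2.2 θ * ξ z :=
  mulOp_ae _ _ ξ

theorem gauge_zero (ξ : H) : gauge 0 ξ = ξ := by
  refine Lp.ext ?_
  filter_upwards [gauge_ae 0 ξ] with z hz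
  rw [hz, fourier_eval_zero, one_mul]

theorem norm_gauge_le (θ : UnitAddCircle) (ξ : H) : ‖gauge θ ξ‖ ≤ ‖ξ‖ := by
  refine Lp.norm_le_norm_of_ae_le ?_
  filter_upwards [gauge_ae θ ξ] with z hz
  rw [hz, norm_mul, norm_fourier_apply, one_mul]

theorem levelProj_gauge (j : ℤ) (θ : UnitAddCircle) (ξ : H) :
    levelProj j (gauge θ ξ) = fourier j θ • levelProj j ξ := by
  refine Lp.ext ?_
  filter_upwards [levelProj_ae j (gauge θ ξ), gauge_ae θ ξ, levelProj_ae j ξ,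
    Lp.coeFn_smul (fourier j θ) (levelProj j ξ)] with z h1 h2 h3 h4
  rw [h1, h4, Pi.smul_apply, h3]
  split_ifs with h
  · rw [h2, h, smul_eq_mul]
  · rw [smul_zero]

/-- Only strong continuity is available; it is dominated convergence, the multipliers being
unimodular. -/
theorem continuous_gauge_apply (ξ : H) : Continuous fun θ => gauge θ ξ := by
  refine continuous_iff_seqContinuous.mpr fun u θ hu => ?_
  refine tendsto_Lp_two_of_dominated _ _ ξ (fun n => ?_) ?_
  · filter_upwards [gauge_ae (u n) ξ] with z hz
    rw [Function.comp_apply, hz, norm_mul, norm_fourier_apply, one_mul]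
  · filter_upwards [ae_all_iff.mpr fun n => gauge_ae (u n) ξ, gauge_ae θ ξ] with z h1 h2
    simp only [Function.comp_apply, h1, h2]
    exact (((fourier z.2.2).continuous.tendsto θ).comp hu).mul_const _

theorem continuous_conj_gauge (T : H →L[ℂ] H) (ξ : H) :
    Continuous fun θ => gauge (-θ) (T (gauge θ ξ)) := by
  have h1 : Continuous fun θ => T (gauge θ ξ) := T.continuous.comp (continuous_gauge_apply ξ)
  rw [continuous_iff_continuousAt]
  intro θ₀
  have h2 : Tendsto (fun θ => gauge (-θ) (T (gauge θ₀ ξ))) (𝓝 θ₀)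
      (𝓝 (gauge (-θ₀) (T (gauge θ₀ ξ)))) :=
    ((continuous_gauge_apply _).comp continuous_neg).tendsto θ₀
  have h3 : Tendsto (fun θ => gauge (-θ) (T (gauge θ ξ) - T (gauge θ₀ ξ))) (𝓝 θ₀) (𝓝 0) := by
    refine squeeze_zero_norm (fun θ => norm_gauge_le _ _) ?_
    have := (h1.tendsto θ₀).sub_const (T (gauge θ₀ ξ))
    rw [sub_self] at this
    simpa using this.norm
  have h4 := h3.add h2
  rw [zero_add] at h4
  refine h4.congr fun θ => ?_
  rw [map_sub, sub_add_cancel]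

theorem integrable_fourier_smul {E : Type*} [NormedAddCommGroup E] [NormedSpace ℂ E]
    {f : UnitAddCircle → E} (hf : Continuous f) (n : ℤ) :
    Integrable (fun θ => fourier n θ • f θ) AddCircle.haarAddCircle :=
  ((fourier n).continuous.smul hf).integrable_of_hasCompactSupport
    (HasCompactSupport.of_compactSpace _)

theorem map_fourierCoeff {E F : Type*} [NormedAddCommGroup E] [NormedSpace ℂ E] [CompleteSpace E]
    [NormedAddCommGroup F] [NormedSpace ℂ F] [CompleteSpace F] (L : E →L[ℂ] F)
    {f : UnitAddCircle → E} (hf : Continuous f) (n : ℤ) :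
    L (fourierCoeff f n) = fourierCoeff (fun θ => L (f θ)) n := by
  rw [fourierCoeff, ← L.integral_comp_comm (integrable_fourier_smul hf _), fourierCoeff]
  simp_rw [map_smul]

theorem fourierCoeff_gauge (ξ : H) (j : ℤ) : fourierCoeff (fun θ => gauge θ ξ) j =
    levelProj j ξ := by
  refine ext_levelProj fun i => ?_
  rw [map_fourierCoeff _ (continuous_gauge_apply ξ), levelProj_levelProj]
  simp_rw [levelProj_gauge]
  have : fourierCoeff (fun θ : UnitAddCircle => fourier i θ • levelProj i ξ) j =
      fourierCoeff (fun θ : UnitAddCircle => fourier i θ) j • levelProj i ξ := by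
    simp only [fourierCoeff]
    rw [← integral_smul_const]
    exact integral_congr_ae (.of_forall fun θ => (smul_assoc _ _ _).symm)
  rw [this, fourierCoeff_fourier]
  by_cases h : i = j
  · subst h; simp
  · simp [h, Ne.symm h]

/-- The Fourier components of `T` under the gauge action. -/
def gaugeComponent (T : H →L[ℂ] H) (q : ℤ) (ξ : H) : H :=
  fourierCoeff (fun θ => gauge (-θ) (T (gauge θ ξ))) q

/-- On level p the factor `gauge (-θ)` is the scalar e^{-2πipθ}, so the q-th coefficient becomes the
(p + q)-th coefficient of `T (gauge θ ξ)`, which selects the part of ξ on level p + q. -/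
theorem levelProj_gaugeComponent (T : H →L[ℂ] H) (q : ℤ) (ξ : H) (p : ℤ) :
    levelProj p (gaugeComponent T q ξ) = levelProj p (T (levelProj (p + q) ξ)) := by
  rw [gaugeComponent, map_fourierCoeff _ (continuous_conj_gauge T ξ), ← fourierCoeff_gauge ξ (p + q),
    map_fourierCoeff T (continuous_gauge_apply ξ),
    map_fourierCoeff _ (f := fun θ => T (gauge θ ξ))
      (T.continuous.comp (continuous_gauge_apply ξ))]
  simp_rw [levelProj_gauge]
  simp only [fourierCoeff]
  refine integral_congr_ae (.of_forall fun θ => ?_)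
  simp only
  rw [← smul_assoc, smul_eq_mul]
  congr 1
  have : fourier p (-θ) = fourier (-p) θ := by simp [fourier_apply]
  rw [this, ← fourier_add, show -q + -p = -(p + q) by ring]

theorem gaugeComponent_ae {T : H →L[ℂ] H} (hT : ∀ f : Lp ℂ ∞ haarRT, Commute T (V f)) (q : ℤ)
    (ξ : H) : ∀ᵐ z ∂haar, gaugeComponent T q ξ z =
      kernel T q z * ξ (z.1, z.2.1, z.2.2 + q) := by
  filter_upwards [ae_all_iff.mpr fun p => levelProj_ae p (gaugeComponent T q ξ),
    ae_all_iff.mpr fun p => levelProj_ae p (T (levelProj (p + q) ξ)),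
    ae_all_iff.mpr fun p => apply_levelProj_ae hT (p + q) ξ] with z h1 h2 h3
  have h4 := h1 z.2.2
  rw [levelProj_gaugeComponent, h2, if_pos rfl, if_pos rfl, h3] at h4
  rw [← h4, kernel]
  ring

/-- An operator is annihilated by a sum of matrix coefficients that annihilates its Fourier
components. -/
theorem sum_inner_eq_zero_of_gaugeComponent {ι : Type*} [Fintype ι] (T : H →L[ℂ] H) (ξ η : ι → H)
    (h : ∀ q, ∑ i, inner ℂ (η i) (gaugeComponent T q (ξ i)) = 0) :
    ∑ i, inner ℂ (η i) (T (ξ i)) = 0 := by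
  have hcont : ∀ i, Continuous fun θ => inner ℂ (η i) (gauge (-θ) (T (gauge θ (ξ i)))) :=
    fun i => continuous_const.inner (continuous_conj_gauge T (ξ i))
  -- The functional along the gauge orbit of `T` is continuous in θ with all Fourier coefficients
  -- zero; θ = 0 recovers `T`.
  have h0 := eq_zero_of_fourierCoeff_eq_zero
    (fun θ => ∑ i, inner ℂ (η i) (gauge (-θ) (T (gauge θ (ξ i)))))
    (continuous_finsetSum _ fun i _ => hcont i) (fun q => ?_) 0
  · simpa only [neg_zero, gauge_zero] using h0
  · rw [← h q]
    simp only [fourierCoeff, Finset.smul_sum]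
    rw [integral_finsetSum _ fun i _ => integrable_fourier_smul (hcont i) (-q)]
    refine Finset.sum_congr rfl fun i _ => ?_
    exact (map_fourierCoeff (innerSL ℂ (η i)) (continuous_conj_gauge T (ξ i)) q).symm

/-- The density of `∑ i ⟪η i, · ξ i⟫` on the diagonal `q`. -/
def diagonalDensity {ι : Type*} [Fintype ι] (ξ η : ι → H) (q : ℤ) (z : G) : ℂ :=
  ∑ i, (starRingEnd ℂ) (η i z) * ξ i (z.1, z.2.1, z.2.2 + q)

theorem integrable_diagonalDensity {ι : Type*} [Fintype ι] (ξ η : ι → H) (q : ℤ) :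
    Integrable (diagonalDensity ξ η q) haar := by
  refine integrable_finsetSum _ fun i _ => ?_
  refine (L2.integrable_inner (𝕜 := ℂ) (η i) (transOp (0, 0, q) (ξ i))).congr ?_
  filter_upwards [transOp_ae (0, 0, q) (ξ i)] with z hz
  rw [hz, RCLike.inner_apply, mul_comm]
  simp [Prod.add_def]

theorem sum_inner_eq_integral_diagonalDensity {ι : Type*} [Fintype ι] (ξ η ζ : ι → H) (q : ℤ)
    (K : G → ℂ) (h : ∀ i, ∀ᵐ z ∂haar, ζ i z = K z * ξ i (z.1, z.2.1, z.2.2 + q)) :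
    Integrable (fun z => K z * diagonalDensity ξ η q z) haar ∧
      ∑ i, inner ℂ (η i) (ζ i) = ∫ z, K z * diagonalDensity ξ η q z ∂haar := by
  have hae : (fun z => ∑ i, inner ℂ (η i z) (ζ i z)) =ᵐ[haar]
      fun z => K z * diagonalDensity ξ η q z := by
    filter_upwards [ae_all_iff.mpr h] with z hz
    rw [diagonalDensity, Finset.mul_sum]
    refine Finset.sum_congr rfl fun i _ => ?_
    rw [RCLike.inner_apply, hz]
    ring
  have hint := fun i => L2.integrable_inner (𝕜 := ℂ) (η i) (ζ i)
  refine ⟨(integrable_finsetSum _ fun i _ => hint i).congr hae, ?_⟩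
  rw [← integral_congr_ae hae, integral_finsetSum _ fun i _ => hint i]
  simp only [L2.inner_def]

/-! ### Unfolding integrals over the fundamental domain -/

theorem measurePreserving_prodProdProdComm {α β γ δ : Type*} [MeasurableSpace α]
    [MeasurableSpace β] [MeasurableSpace γ] [MeasurableSpace δ] (μa : Measure α) (μb : Measure β)
    (μc : Measure γ) (μd : Measure δ) [SFinite μa] [SFinite μb] [SFinite μc] [SFinite μd] :
    MeasurePreserving (fun w : (α × β) × (γ × δ) => ((w.1.1, w.2.1), (w.1.2, w.2.2)))
      ((μa.prod μb).prod (μc.prod μd)) ((μa.prod μc).prod (μb.prod μd)) := by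
  have h1 := measurePreserving_prodAssoc μa μb (μc.prod μd)
  have h2 := (MeasurePreserving.id μa).prod (measurePreserving_prodAssoc μb μc μd).symm
  have h3 := (MeasurePreserving.id μa).prod
    ((Measure.measurePreserving_swap (μ := μb) (ν := μc)).prod (MeasurePreserving.id μd))
  have h4 := (MeasurePreserving.id μa).prod (measurePreserving_prodAssoc μc μb μd)
  have h5 := (measurePreserving_prodAssoc μa μc (μb.prod μd)).symm
  exact h5.comp (h4.comp (h3.comp (h2.comp h1)))

theorem measurePreserving_add_zsmul {a : ℝ} (ha : 0 < a) :
    MeasurePreserving (fun w : ℝ × ℤ => w.1 + a * w.2)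
      ((volume.restrict (Set.Ioo 0 a)).prod Measure.count) volume := by
  have hm : Measurable fun w : ℝ × ℤ => w.1 + a * w.2 :=
    measurable_fst.add (((measurable_of_countable fun n : ℤ => (n : ℝ)).comp
      measurable_snd).const_mul a)
  refine ⟨hm, ?_⟩
  -- Half-open intervals tile ℝ exactly; the open interval is kept in the statement because test
  -- functions need an open domain.
  rw [Measure.restrict_congr_set Ioo_ae_eq_Ioc]
  ext s hs
  rw [Measure.map_apply hm hs, Measure.prod_apply_symm (hm hs), lintegral_count]
  have hcov : s = ⋃ n : ℤ, s ∩ Set.Ioc (n • a) ((n + 1) • a) := by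
    rw [← Set.inter_iUnion, iUnion_Ioc_zsmul ha, Set.inter_univ]
  conv_rhs => rw [hcov]
  rw [measure_iUnion]
  · refine tsum_congr fun n => ?_
    rw [Measure.restrict_apply (measurable_prodMk_right (hm hs)),
      ← measure_preimage_add_right volume (a * n) (s ∩ _)]
    congr 1
    ext x
    simp only [Set.mem_inter_iff, Set.mem_preimage, Set.mem_Ioc, zsmul_eq_mul, Int.cast_add,
      Int.cast_one]
    refine and_congr_right fun _ => ⟨fun h => ⟨by linarith [h.1], by linarith [h.2]⟩,
      fun h => ⟨by linarith [h.1], by linarith [h.2]⟩⟩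
  · exact fun i j hij => (Set.pairwise_disjoint_Ioc_zsmul a hij).mono
      Set.inter_subset_right Set.inter_subset_right
  · exact fun n => hs.inter measurableSet_Ioc

theorem measurePreserving_coe_Ioo : MeasurePreserving (fun y : ℝ => (y : UnitAddCircle))
    (volume.restrict (Set.Ioo 0 1)) volume := by
  have := UnitAddCircle.measurePreserving_mk 0
  rw [zero_add] at this
  rw [Measure.restrict_congr_set Ioo_ae_eq_Ioc]
  exact this

theorem measurePreserving_shear (a : ℤ → ℝ) (b : ℤ → UnitAddCircle) :
    MeasurePreserving (fun z : G => ((z.1 + a z.2.2, z.2.1 + b z.2.2, z.2.2) : G)) haar haar := by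
  have h0 : MeasurePreserving (MeasurableEquiv.prodAssoc.symm :
      G ≃ᵐ (ℝ × UnitAddCircle) × ℤ) haar (haarRT.prod Measure.count) :=
    (measurePreserving_prodAssoc volume volume Measure.count).symm
  have : SigmaFinite haarRT := by unfold haarRT; infer_instance
  have hs : MeasurePreserving (fun w : ℤ × (ℝ × UnitAddCircle) => (w.1, (w.2.1 + a w.1,
      w.2.2 + b w.1))) ((Measure.count : Measure ℤ).prod haarRT) (Measure.count.prod haarRT) := by
    refine (MeasurePreserving.id _).skew_product
      (g := fun (p : ℤ) (w : ℝ × UnitAddCircle) => (w.1 + a p, w.2 + b p)) ?_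
      (.of_forall fun p => ?_)
    · exact measurable_from_prod_countable_right fun p => by
        change Measurable fun w : ℝ × UnitAddCircle => (w.1 + a p, w.2 + b p)
        fun_prop
    · exact ((measurePreserving_add_right volume (a p)).prod
        (measurePreserving_add_right volume (b p))).map_eq
  exact h0.symm.comp (Measure.measurePreserving_swap.comp
    (hs.comp (Measure.measurePreserving_swap.comp h0)))

/-- A fundamental domain for the deck transformations and the level shifts. -/
def fundDomain : Set (ℝ × ℝ) := Set.Ioo 0 (2 * Real.pi) ×ˢ Set.Ioo 0 1

/-- The unfolding map of the fundamental domain, adapted to the diagonal `s`. -/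
def unfold (ħ μ ν : ℝ) (s : ℤ) (w : (ℝ × ℝ) × (ℤ × ℤ)) : G :=
  (w.1.1 + 2 * Real.pi * w.2.1 + ħ * (s - 2 * w.2.2) * μ,
    (w.1.2 : UnitAddCircle) + ((ħ * (s - 2 * w.2.2) * ν : ℝ) : UnitAddCircle), w.2.2)

theorem measurePreserving_unfold (ħ μ ν : ℝ) (s : ℤ) : MeasurePreserving (unfold ħ μ ν s)
    ((volume.restrict fundDomain).prod (Measure.count.prod Measure.count)) haar := by
  have h1 := measurePreserving_prodProdProdComm (volume.restrict (Set.Ioo 0 (2 * Real.pi)))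
    (volume.restrict (Set.Ioo (0 : ℝ) 1)) (Measure.count : Measure ℤ) (Measure.count : Measure ℤ)
  rw [Measure.prod_restrict] at h1
  have h2 := (measurePreserving_add_zsmul Real.two_pi_pos).prod
    (measurePreserving_coe_Ioo.prod (MeasurePreserving.id (Measure.count : Measure ℤ)))
  exact (measurePreserving_shear (fun p => ħ * (s - 2 * p) * μ)
    (fun p => ((ħ * (s - 2 * p) * ν : ℝ) : UnitAddCircle))).comp (h2.comp h1)

/-- Fubini gives almost every `k`, hence every `k`, since points have positive counting measure. -/
theorem ae_forall_unfold (ħ μ ν : ℝ) (s : ℤ) {Q : G → Prop} (h : ∀ᵐ z ∂haar, Q z) :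
    ∀ᵐ w ∂volume.restrict fundDomain, ∀ k, Q (unfold ħ μ ν s (w, k)) := by
  have h1 := Measure.ae_ae_of_ae_prod
    ((measurePreserving_unfold ħ μ ν s).quasiMeasurePreserving.ae h)
  filter_upwards [h1] with w hw k
  by_contra hk
  rw [ae_iff] at hw
  have h2 := measure_mono_null (Set.singleton_subset_iff.mpr hk) hw
  rw [← Prod.mk.eta (p := k), ← Set.singleton_prod_singleton, Measure.prod_prod,
    Measure.count_singleton, Measure.count_singleton] at h2
  simp at h2

/-- The factor by which functions on the diagonal `s` change under the `m`-th deck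
transformation. -/
def twist (c : ℕ) (s m : ℤ) (y : ℝ) : ℂ := Complex.exp (Complex.I * c * (2 * Real.pi * m) * s * y)

theorem norm_twist (c : ℕ) (s m : ℤ) (y : ℝ) : ‖twist c s m y‖ = 1 := by
  rw [twist, show Complex.I * c * (2 * Real.pi * m) * s * y =
    ((c * (2 * Real.pi * m) * s * y : ℝ) : ℂ) * Complex.I by push_cast; ring,
    Complex.norm_exp_ofReal_mul_I]

theorem measurable_twist (c : ℕ) (s : ℤ) :
    Measurable fun w : (ℝ × ℝ) × (ℤ × ℤ) => twist c s w.2.1 w.1.2 := by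
  have h : Measurable fun w : (ℝ × ℝ) × (ℤ × ℤ) => (w.2.1 : ℂ) :=
    (measurable_of_countable fun n : ℤ => (n : ℂ)).comp measurable_snd.fst
  unfold twist
  fun_prop

/-- The twisted periodization of a function on `ℝ × 𝕋 × ℤ`. -/
def foldDensity (c : ℕ) (ħ μ ν : ℝ) (s : ℤ) (g : G → ℂ) (w : ℝ × ℝ) : ℂ :=
  ∫ k : ℤ × ℤ, twist c s k.1 w.2 * g (unfold ħ μ ν s (w, k)) ∂Measure.count.prod Measure.count

theorem integrable_foldDensity (c : ℕ) (ħ μ ν : ℝ) (s : ℤ) {g : G → ℂ} (hg : Integrable g haar) :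
    Integrable (foldDensity c ħ μ ν s g) (volume.restrict fundDomain) := by
  have h1 := (measurePreserving_unfold ħ μ ν s).integrable_comp_of_integrable hg
  exact (h1.bdd_mul (measurable_twist c s).aestronglyMeasurable
    (.of_forall fun w => (norm_twist c s _ _).le)).integral_prod_left

/-- Unfolding: after the change of variables and Fubini, `K` depends on `k` only through the twist,
so φ leaves the inner integral and the rest is the folded density. -/
theorem integral_mul_eq_integral_foldDensity (c : ℕ) (ħ μ ν : ℝ) (s : ℤ) {g K : G → ℂ}
    {φ : ℝ × ℝ → ℂ} (hK : Integrable (fun z => K z * g z) haar)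
    (h : ∀ᵐ w ∂volume.restrict fundDomain, ∀ k : ℤ × ℤ,
      K (unfold ħ μ ν s (w, k)) = twist c s k.1 w.2 * φ w) :
    ∫ z, K z * g z ∂haar = ∫ w in fundDomain, φ w * foldDensity c ħ μ ν s g w := by
  have hΨ := measurePreserving_unfold ħ μ ν s
  have hi : Integrable (fun w => K (unfold ħ μ ν s w) * g (unfold ħ μ ν s w)) _ :=
    hΨ.integrable_comp_of_integrable hK
  rw [← hΨ.map_eq, integral_map hΨ.measurable.aemeasurable
    (by rw [hΨ.map_eq]; exact hK.aestronglyMeasurable),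
    integral_prod _ hi]
  refine integral_congr_ae ?_
  filter_upwards [h] with w hw
  simp only [foldDensity]
  rw [← integral_const_mul]
  refine integral_congr_ae (.of_forall fun k => ?_)
  simp only
  rw [hw]
  ring

/-! ### The theorem -/

theorem ActsBy.ae_of_level {ħ μ ν : ℝ} {Φ : G → ℂ} {A : H →L[ℂ] H} (hA : ActsBy ħ μ ν Φ A)
    {s : ℤ} (hs : ∀ x y p, p ≠ s → Φ (x, y, p) = 0) (ξ : H) :
    ∀ᵐ z ∂haar, A ξ z = Φ (z.1 - ħ * (s - 2 * z.2.2) * μ,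
      z.2.1 - ((ħ * (s - 2 * z.2.2) * ν : ℝ) : UnitAddCircle), s) *
        ξ (z.1, z.2.1, z.2.2 - s) := by
  filter_upwards [hA ξ] with z hz
  refine hz.unique (hasSum_single s fun q hq => ?_)
  rw [hs _ _ q hq, zero_mul]

/-- The fundamental lemma of the calculus of variations: each test function on the open domain is
the restriction of some Φ ∈ `S^c` living on level `s`, whose operator lives on the diagonal `-s`. -/
theorem foldDensity_ae_eq_zero {c : ℕ} {ħ μ ν : ℝ} {ι : Type*} [Fintype ι] {ξ η : ι → H}
    (h : ∀ A ∈ scOps c ħ μ ν, ∑ i, inner ℂ (η i) (A (ξ i)) = 0) (s : ℤ) :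
    ∀ᵐ w ∂volume.restrict fundDomain,
      foldDensity c ħ μ ν s (diagonalDensity ξ η (-s)) w = 0 := by
  have hU : IsOpen fundDomain := isOpen_Ioo.prod isOpen_Ioo
  rw [ae_restrict_iff' hU.measurableSet]
  refine hU.ae_eq_zero_of_integral_contDiff_smul_eq_zero
    (IntegrableOn.locallyIntegrableOn
      (integrable_foldDensity c ħ μ ν s (integrable_diagonalDensity ξ η (-s))))
    fun ψ hψ hψc hψU => ?_
  obtain ⟨Φ, hΦ, hΦs, hΦψ⟩ := exists_isSc_extension c s hψ hψc hψU
  obtain ⟨A, hA⟩ := hΦ.exists_actsBy ħ μ ν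
  have h0 := h A ⟨Φ, hΦ, hA⟩
  obtain ⟨h1, h2⟩ := sum_inner_eq_integral_diagonalDensity ξ η (fun i => A (ξ i)) (-s) _
    fun i => hA.ae_of_level hΦs (ξ i)
  rw [h2, integral_mul_eq_integral_foldDensity c ħ μ ν s (φ := fun w => ψ w) h1] at h0
  · rw [← setIntegral_eq_integral_of_forall_compl_eq_zero (s := fundDomain)]
    · exact h0
    · intro w hw
      rw [image_eq_zero_of_notMem_tsupport fun hw' => hw (hψU hw'), zero_smul]
  · rw [ae_restrict_iff' hU.measurableSet]
    refine .of_forall fun w hw k => ?_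
    have h3 := hΦ.twisted k.1 w.1 w.2 s
    rw [hΦψ _ _ hw] at h3
    -- The offset ħ(s − 2p)(μ, ν) built into `unfold` cancels the displacement in the action,
    -- leaving Φ at (x + 2πm, y, s).
    simp only [unfold, add_sub_cancel_right]
    exact h3

theorem kernel_unfold {c : ℕ} {ħ μ ν : ℝ} {T : H →L[ℂ] H}
    (hV : ∀ f : Lp ℂ ∞ haarRT, Commute T (V f)) (hW : ∀ m : ℤ, Commute T (W c ħ ν m))
    (hX : ∀ r : ℤ, Commute T (X ħ μ ν r)) (s : ℤ) :
    ∀ᵐ w ∂volume.restrict fundDomain, ∀ k : ℤ × ℤ, kernel T (-s) (unfold ħ μ ν s (w, k)) =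
      twist c s k.1 w.2 * kernel T (-s) (unfold ħ μ ν s (w, 0)) := by
  filter_upwards [ae_forall_unfold ħ μ ν s (ae_all_iff.mpr (kernel_X hV hX (-s))),
    ae_forall_unfold ħ μ ν s (ae_all_iff.mpr (kernel_W hV hW (-s)))] with w h1 h2 k
  obtain ⟨m, p⟩ := k
  obtain ⟨x, y⟩ := w
  -- The shift r = −p moves the point to level 0, where the phase on the left of `kernel_W` is 1.
  rw [← h1 (m, p) (-p)]
  have h3 := h2 0 m
  simp only [unfold, Prod.fst_zero, Prod.snd_zero, ← AddCircle.coe_add, ← AddCircle.coe_sub,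
    phase_coe] at h3 ⊢
  rw [show (0 : ℤ) + -s = -s by ring] at h3
  have e1 : Complex.exp (-(Complex.I * c * (2 * Real.pi * m) * (((0 : ℤ) : ℂ) ^ 2 * ħ * ν +
      ((0 : ℤ) : ℂ) * ((y + ħ * (s - 2 * ((0 : ℤ) : ℝ)) * ν : ℝ) : ℂ)))) = 1 := by simp
  -- At level −s the quadratic term s²ħν cancels against the offset ħsν in the second coordinate,
  -- leaving exactly the twist.
  have e2 : Complex.exp (-(Complex.I * c * (2 * Real.pi * m) * (((-s : ℤ) : ℂ) ^ 2 * ħ * ν +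
      ((-s : ℤ) : ℂ) * ((y + ħ * (s - 2 * ((0 : ℤ) : ℝ)) * ν : ℝ) : ℂ)))) = twist c s m y := by
    rw [twist]
    congr 1
    push_cast
    ring
  rw [e1, e2, one_mul] at h3
  rw [← h3, show p + -p = 0 by ring,
    show x + 2 * Real.pi * m + ħ * (s - 2 * p) * μ - 2 * ħ * (-p : ℤ) * μ =
      x + 2 * Real.pi * (0 : ℤ) + ħ * (s - 2 * (0 : ℤ)) * μ + 2 * Real.pi * m by
        push_cast; ring,
    show y + ħ * (s - 2 * p) * ν - 2 * ħ * (-p : ℤ) * ν = y + ħ * (s - 2 * (0 : ℤ)) * ν by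
      push_cast; ring]

theorem mem_N_of_commute {c : ℕ} {ħ μ ν : ℝ} {T : H →L[ℂ] H}
    (hV : ∀ f : Lp ℂ ∞ haarRT, Commute T (V f)) (hW : ∀ m : ℤ, Commute T (W c ħ ν m))
    (hX : ∀ r : ℤ, Commute T (X ħ μ ν r)) : T ∈ N c ħ μ ν := by
  refine ofCLM_mem_closure_of_forall_sum_inner (scOps c ħ μ ν) T fun ι _ ξ η h => ?_
  refine sum_inner_eq_zero_of_gaugeComponent T ξ η fun q => ?_
  -- Level `s` of `S^c` reads ξ at p − s, whereas the diagonal `q` reads it at p + q.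
  obtain ⟨s, rfl⟩ : ∃ s, q = -s := ⟨-q, by ring⟩
  obtain ⟨h1, h2⟩ := sum_inner_eq_integral_diagonalDensity ξ η
    (fun i => gaugeComponent T (-s) (ξ i)) (-s) _ fun i => gaugeComponent_ae hV (-s) (ξ i)
  rw [h2, integral_mul_eq_integral_foldDensity c ħ μ ν s h1 (kernel_unfold hV hW hX s)]
  refine integral_eq_zero_of_ae ?_
  filter_upwards [foldDensity_ae_eq_zero h s] with w hw
  rw [hw, mul_zero, Pi.zero_apply]

end QuantumHeisenberg

end

theorem theorem6 (c : ℕ) (hc : 0 < c) (ħ μ ν : ℝ)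
    (T : QuantumHeisenberg.H →L[ℂ] QuantumHeisenberg.H) :
    T ∈ QuantumHeisenberg.N c ħ μ ν ↔
      (∀ f : Lp ℂ ∞ QuantumHeisenberg.haarRT, Commute T (QuantumHeisenberg.V f)) ∧
      (∀ m : ℤ, Commute T (QuantumHeisenberg.W c ħ ν m)) ∧
      (∀ r : ℤ, Commute T (QuantumHeisenberg.X ħ μ ν r)) :=
  ⟨QuantumHeisenberg.commute_of_mem_N, fun h =>
    QuantumHeisenberg.mem_N_of_commute h.1 h.2.1 h.2.2⟩
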